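/- Let $r\ge 1$ and $n\ge 5r+4$. For a finite graph $G$ let $\mathrm{Ind}(G)$ be its independence complex (the simplicial complex of independent sets of vertices, identified with its geometric realization). For a vertex $u$ let $N[u]$ be its closed neighbourhood, for an edge $e=(u,v)$ put $N[e]=N[u]\cup N[v]$, let $G\setminus N[e]$ be the subgraph induced by the complement of $N[e]$, and let $e\sqcup(G\setminus N[e])$ be the subgraph induced by $\{u,v\}\cup (V(G)\setminus N[e])$. Let $\Sigma$ be the unreduced suspension (so $\Sigma\emptyset=S^0$), based at a pole. Let $C_n^r$ be the $r$-th distance power of the $n$-cycle with vertex set $\mathbb{Z}/n$: distinct vertices are adjacent if and only if their distance in the cycle is at most $r$. Consider the following sequence $e_1,\dots,e_k$ of pairs of vertices. First phase: for $s=1,\dots,r-1$ in turn, first the pairs $(i,\,i+2r-s+2)$ for $i=1,\dots,r+s+1$ in turn, then the pairs $(i,\,i+3r-s+3)$ for $i=1,\dots,s$ in turn. Second phase: all pairs $(-x,\,3r+3+y)$ with $0\le x\le r-1$, $1\le y\le r$, $x+y\le r$, each once, in an arbitrary order. Put $G_0=C_n^r$ and $G_i=G_{i-1}\cup e_i$ for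 $1\le i\le k$, and let $\overline{C_n^r}$ be the graph obtained from $C_n^r$ by adding all the edges of both phases. Then: 1. For every $i=1,\dots,k$, writing $e_i=(u,v)$, we have $u\ne v$, the edge $e_i$ is not an edge of $G_{i-1}$, and the inclusion $\mathrm{Ind}(e_i\sqcup(G_i\setminus N_{G_i}[e_i]))\hookrightarrow\mathrm{Ind}(G_i)$ is null-homotopic. Moreover: - if $e_i$ belongs to the first phase, there are vertices $x,y\in N_{G_i}[e_i]$ with $N_{G_i}[x]\cup N_{G_i}[y]\subseteq N_{G_i}[e_i]$ such that the subgraph of $G_i$ induced by $\{x,y,u,v\}$ is isomorphic to the path $P_4$ on four vertices; - if $e_i$ belongs to the second phase, there is a set $U$ of vertices with $\{u,v\}\cup (V(G_i)\setminus N_{G_i}[e_i])\subseteq U$ such that $\mathrm{Ind}(G_i[U])$ is contractible, so that the above inclusion factors through a contractible complex. 2. $G_k=\overline{C_n^r}$, and for every choice of base point in $\mathrm{Ind}(\overline{C_n^r})$ there is a homotopy equivalence $$\mathrm{Ind}(C_n^r)\simeq \mathrm{Ind}(\overline{C_n^r})\vee\bigvee_{i=1}^k\Sigma^2\,\mathrm{Ind}(G_i\setminus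 N_{G_i}[e_i]).$$ -/

import Mathlib

open scoped unitInterval ContinuousMap

namespace IndCplx

/-! ### Independence complexes and their geometric realizations -/

/-- The independence complex `Ind(G)`: vertices are those of `G`, faces are the (nonempty, finite)
independent sets of `G`. -/
def Ind {V : Type*} (G : SimpleGraph V) : AbstractSimplicialComplex V where
  faces := {s | s.Nonempty ∧ G.IsIndepSet (s : Set V)}
  isRelLowerSet_faces := fun _ hs =>
    ⟨hs.1, fun _ hts ht => ⟨ht, Set.Pairwise.mono (Finset.coe_subset.mpr hts) hs.2⟩⟩
  singleton_mem := fun v => ⟨Finset.singleton_nonempty v, by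
    simp [SimpleGraph.IsIndepSet]⟩

/-- The points of the geometric realization `|K|` in barycentric coordinates: nonnegative weights
with total sum `1`, supported on a face of `K`. -/
def realizationSet {V : Type*} (K : AbstractSimplicialComplex V) : Set (V → ℝ) :=
  {x | (∀ v, 0 ≤ x v) ∧ ∃ s ∈ K.faces, (∀ v, v ∉ s → x v = 0) ∧ ∑ v ∈ s, x v = 1}

/-- The geometric realization of a simplicial complex on a finite vertex set, with the subspace
topology of `V → ℝ`. -/
abbrev Realization {V : Type*} [Finite V] (K : AbstractSimplicialComplex V) : Type _ :=
  realizationSet K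

/-- Extending barycentric coordinates by zero maps `|Ind(G[S])|` into `|Ind(G)|`. -/
theorem extend_mem_realizationSet {V : Type*} (G : SimpleGraph V) (S : Set V) (x : S → ℝ)
    (hx : x ∈ realizationSet (Ind (G.induce S))) :
    Function.extend ((↑) : S → V) x 0 ∈ realizationSet (Ind G) := by
  obtain ⟨h0, s, ⟨hne, hs⟩, hz, h1⟩ := hx
  refine ⟨fun v => ?_, s.map (Function.Embedding.subtype _), ⟨by simpa using hne, ?_⟩,
    fun v hv => ?_, ?_⟩
  · by_cases hv : v ∈ S
    · simpa [Subtype.val_injective.extend_apply x 0 (⟨v, hv⟩ : S)] using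
        (Subtype.val_injective.extend_apply x 0 (⟨v, hv⟩ : S)).symm ▸ h0 ⟨v, hv⟩
    · rw [Function.extend_apply' _ _ _ (by simpa using hv)]
      simp
  · intro a ha b hb hab
    simp only [Finset.coe_map, Function.Embedding.subtype_apply, Set.mem_image] at ha hb
    obtain ⟨a', ha', rfl⟩ := ha
    obtain ⟨b', hb', rfl⟩ := hb
    exact hs ha' hb' (fun h => hab (congrArg _ h))
  · by_cases hvS : v ∈ S
    · have hvs : (⟨v, hvS⟩ : S) ∉ s := fun h =>
        hv (Finset.mem_map.mpr ⟨⟨v, hvS⟩, h, rfl⟩)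
      exact (Subtype.val_injective.extend_apply x 0 (⟨v, hvS⟩ : S)).trans (hz _ hvs)
    · rw [Function.extend_apply' _ _ _ (by simpa using hvS)]
      simp
  · rw [Finset.sum_map, ← h1]
    exact Finset.sum_congr rfl fun v _ => Subtype.val_injective.extend_apply x 0 v

/-- The inclusion `Ind(G[S]) ↪ Ind(G)` on geometric realizations, for a set `S` of vertices. -/
noncomputable def indInclusion {V : Type*} [Finite V] (G : SimpleGraph V) (S : Set V) :
    C(Realization (Ind (G.induce S)), Realization (Ind G)) where
  toFun x := ⟨Function.extend ((↑) : S → V) x.1 0, extend_mem_realizationSet G S x.1 x.2⟩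
  continuous_toFun := by
    refine Continuous.subtype_mk (continuous_pi fun v => ?_) _
    by_cases hv : v ∈ S
    · have h : ∀ x : Realization (Ind (G.induce S)),
          Function.extend ((↑) : S → V) x.1 0 v = x.1 ⟨v, hv⟩ := fun x =>
        Subtype.val_injective.extend_apply x.1 0 (⟨v, hv⟩ : S)
      simp only [h]
      exact (continuous_apply _).comp continuous_subtype_val
    · have h : ∀ x : Realization (Ind (G.induce S)),
          Function.extend ((↑) : S → V) x.1 0 v = 0 := fun x => by
        rw [Function.extend_apply' _ _ _ (by simpa using hv)]
        simp
      simp only [h]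
      exact continuous_const

/-! ### Suspensions and wedges -/

/-- The generating identifications of the suspension. -/
inductive SuspRel (X : Type*) : (X × I) ⊕ Bool → (X × I) ⊕ Bool → Prop
  | bot (x : X) : SuspRel X (Sum.inl (x, 0)) (Sum.inr false)
  | top (x : X) : SuspRel X (Sum.inl (x, 1)) (Sum.inr true)

/-- The unreduced suspension `ΣX`: the cylinder `X × [0,1]` together with two poles, the bottom of
the cylinder being collapsed to the first pole and the top to the second.
In particular `Σ∅` is a two-point space. -/
def Susp (X : Type*) [TopologicalSpace X] : Type _ := Quot (SuspRel X)

instance (X : Type*) [TopologicalSpace X] : TopologicalSpace (Susp X) :=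
  inferInstanceAs (TopologicalSpace (Quot (SuspRel X)))

/-- The pole of the suspension that serves as its base point. -/
def Susp.pole (X : Type*) [TopologicalSpace X] : Susp X := Quot.mk _ (Sum.inr false)

/-- The generating identifications of the wedge: all base points are glued together. -/
inductive WedgeRel {X : Type*} (p : X) {ι : Type*} {Y : ι → Type*} (q : ∀ i, Y i) :
    X ⊕ (Σ i, Y i) → X ⊕ (Σ i, Y i) → Prop
  | glue (i : ι) : WedgeRel p q (Sum.inr ⟨i, q i⟩) (Sum.inl p)

/-- The wedge `X ∨ ⋁ᵢ Yᵢ` of the pointed spaces `(X, p)` and `(Yᵢ, qᵢ)`. -/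
def Wedge {X : Type*} [TopologicalSpace X] (p : X) {ι : Type*} {Y : ι → Type*}
    [∀ i, TopologicalSpace (Y i)] (q : ∀ i, Y i) : Type _ := Quot (WedgeRel p q)

instance {X : Type*} [TopologicalSpace X] (p : X) {ι : Type*} {Y : ι → Type*}
    [∀ i, TopologicalSpace (Y i)] (q : ∀ i, Y i) : TopologicalSpace (Wedge p q) :=
  inferInstanceAs (TopologicalSpace (Quot (WedgeRel p q)))

/-! ### Graphs -/

/-- The closed neighbourhood `N[u]` of a vertex. -/
def closedNbhd {V : Type*} (G : SimpleGraph V) (u : V) : Set V := insert u (G.neighborSet u)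

/-- The closed neighbourhood `N[e] = N[u] ∪ N[v]` of `e = (u, v)`. -/
def edgeNbhd {V : Type*} (G : SimpleGraph V) (e : V × V) : Set V :=
  closedNbhd G e.1 ∪ closedNbhd G e.2

/-- The vertex set of the induced subgraph `e ⊔ (G ∖ N[e])` of `G`. -/
def edgeAndFar {V : Type*} (G : SimpleGraph V) (e : V × V) : Set V :=
  {e.1, e.2} ∪ (edgeNbhd G e)ᶜ

/-- `G` with the (undirected) edges `(u, v) ∈ S` added. -/
def addEdges {V : Type*} (G : SimpleGraph V) (S : Set (V × V)) : SimpleGraph V :=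
  G ⊔ SimpleGraph.fromEdgeSet {s | ∃ e ∈ S, s = s(e.1, e.2)}

/-- The `r`-th distance power: distinct vertices at distance at most `r` are adjacent. -/
def distPower {V : Type*} (G : SimpleGraph V) (r : ℕ) : SimpleGraph V where
  Adj u v := u ≠ v ∧ G.edist u v ≤ r
  symm := ⟨fun _ _ h => ⟨h.1.symm, SimpleGraph.edist_comm (G := G) ▸ h.2⟩⟩
  loopless := ⟨fun _ h => h.1 rfl⟩

/-- `C_n^r`, the `r`-th distance power of the `n`-cycle with vertices labelled by `ℤ/n`. -/
def cyclePower (n r : ℕ) : SimpleGraph (ZMod n) :=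
  distPower (SimpleGraph.circulantGraph {(1 : ZMod n)}) r

/-- The edges of the first phase, in order: in stage `s = 1, …, r - 1`
first `(i, i + 2r - s + 2)` for `i = 1, …, r + s + 1`,
then `(i, i + 3r - s + 3)` for `i = 1, …, s`. -/
def firstPhase (n r : ℕ) : List (ZMod n × ZMod n) :=
  (List.range' 1 (r - 1)).flatMap fun s =>
    (List.range' 1 (r + s + 1)).map
      (fun i => ((i : ZMod n), (i : ZMod n) + 2 * (r : ZMod n) - (s : ZMod n) + 2)) ++
    (List.range' 1 s).map
      (fun i => ((i : ZMod n), (i : ZMod n) + 3 * (r : ZMod n) - (s : ZMod n) + 3))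

/-- The edges `(-x, 3r + 3 + y)` of the second phase, for
`0 ≤ x ≤ r - 1`, `1 ≤ y ≤ r`, `x + y ≤ r`. -/
def secondPhase (n r : ℕ) : Set (ZMod n × ZMod n) :=
  {e | ∃ x y : ℕ, x < r ∧ 1 ≤ y ∧ y ≤ r ∧ x + y ≤ r ∧
    e = (-(x : ZMod n), 3 * (r : ZMod n) + 3 + (y : ZMod n))}

/-- The graph obtained from `C_n^r` by adding all edges of both phases. -/
def cyclePowerBar (n r : ℕ) : SimpleGraph (ZMod n) :=
  addEdges (cyclePower n r) ({e | e ∈ firstPhase n r} ∪ secondPhase n r)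

/-- `E = (e₁, …, e_k)` lists the edges added to `C_n^r`: the first phase in its prescribed order,
followed by the edges of the second phase, each once, in any order. -/
def IsEdgeSequence (n r : ℕ) (E : List (ZMod n × ZMod n)) : Prop :=
  ∃ L : List (ZMod n × ZMod n), L.Nodup ∧ (∀ e, e ∈ L ↔ e ∈ secondPhase n r) ∧
    E = firstPhase n r ++ L

/-- The graph `G_i` obtained from `C_n^r` by adding the first `i` edges of `E`. -/
def stageGraph (n r : ℕ) (E : List (ZMod n × ZMod n)) (i : ℕ) : SimpleGraph (ZMod n) :=
  addEdges (cyclePower n r) {e | e ∈ E.take i}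

end IndCplx

/-! Let `G` arise from `G'` by adding the edge `e = uv`, and let `F = Ind(G ∖ N[e])`. The simplices
lost in passing from `Ind(G')` to `Ind(G)` are those containing both `u` and `v`; together with
their faces they form the join of the segment `uv` with `F`. The segment is the cone from its
midpoint over its two ends, so `Ind(G')` is `Ind(G)` with a cone attached over `{u, v} * F = ΣF =
Ind(e ⊔ (G ∖ N[e]))` (`exists_isCone_of_edge`, `exists_susp_homeomorph`). If the inclusion of `ΣF`
into `Ind(G)` is null-homotopic, then this mapping cone is `Ind(G) ∨ Σ²F` (`ptdEquiv_of_edge`). The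
equivalences are kept pointed so that they can be iterated inside a wedge
(`PtdEquiv.wedge_of_forall`); path-connectedness lets the null-homotopy end at any prescribed base
point.

The null-homotopy always comes from a contractible `Ind(G[U])` with `U ⊇ e ∪ (G ∖ N[e])`. All
complexes are realized as sets of weights on the same vertex set (`indSet`), so that changing the
graph or the vertex set gives set inclusions.

In the first phase put `x = u + 1` and `y = v - 1`. The order of the edges ensures `N[x] ∪ N[y] ⊆
N[e]`, and `x, u, v, y` is an induced path. Then `U` is this path together with the far vertices,
and `Ind` of a path on four vertices, hence its join with anything, is contractible
(`contractibleSpace_of_path`).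

After the first phase, two distinct vertices of the block `1, …, 3r + 3` are non-adjacent only at
difference `r + 1`, `r + 2`, `2r + 2` or `2r + 3` (`apart_iff`). The independence complex of the
block is a strip of triangles closed up by one extra edge. An edge `(-x, 3r + 3 + y)` of the second
phase is adjacent to two consecutive vertices of the strip, namely `y` through one end and `2r + 3 +
y` through the other. Cutting these out leaves a contractible strip, which stays contractible after
the other neighbours of either end are removed (`contractibleSpace_strip`). Adding the two ends one
after the other therefore preserves contractibility (`exists_contractible_second`). -/

namespace IndCplx

universe u

/-! ### Mapping cones -/

section Cones

variable {A L Z : Type u} [TopologicalSpace A] [TopologicalSpace L] [TopologicalSpace Z]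

/-- `Z` is the mapping cone of `f : A → L`, by means of the inclusion `j` of `L` and the
parametrization `κ` of the cone over `A`, whose base is at height `0` and whose apex is at
height `1`. -/
structure IsCone (f : C(A, L)) (j : C(L, Z)) (κ : C(A × I, Z)) : Prop where
  bot : ∀ a, κ (a, 0) = j (f a)
  top : ∀ a b, κ (a, 1) = κ (b, 1)
  surj : ∀ z, (∃ l, j l = z) ∨ ∃ a s, κ (a, s) = z
  desc : ∀ {T : Type u} [TopologicalSpace T] (g : C(L, T)) (h : C(A × I, T)),
    (∀ a, h (a, 0) = g (f a)) → (∀ a b, h (a, 1) = h (b, 1)) →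
      ∃ k : C(Z, T), (∀ l, k (j l) = g l) ∧ ∀ a s, k (κ (a, s)) = h (a, s)

/-- Homotopies between maps out of a mapping cone are defined separately on `L` and on the cone. -/
theorem IsCone.exists_homotopy {f : C(A, L)} {j : C(L, Z)} {κ : C(A × I, Z)} (hc : IsCone f j κ)
    {T : Type u} [TopologicalSpace T] {k₀ k₁ : C(Z, T)} (G : C(I × L, T)) (H : C(I × (A × I), T))
    (hbot : ∀ t a, H (t, (a, 0)) = G (t, f a)) (htop : ∀ t a b, H (t, (a, 1)) = H (t, (b, 1)))
    (hG0 : ∀ l, G (0, l) = k₀ (j l)) (hG1 : ∀ l, G (1, l) = k₁ (j l))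
    (hH0 : ∀ a s, H (0, (a, s)) = k₀ (κ (a, s))) (hH1 : ∀ a s, H (1, (a, s)) = k₁ (κ (a, s))) :
    ∃ F : k₀.Homotopy k₁, ∀ t l, F (t, j l) = G (t, l) := by
  -- Applying the universal property to maps into the path space `C(I, T)` and uncurrying avoids
  -- showing that `Z × I` is again a quotient.
  obtain ⟨k, hk1, hk2⟩ := hc.desc (T := C(I, T))
    (ContinuousMap.curry (G.comp ⟨Prod.swap, continuous_swap⟩))
    (ContinuousMap.curry (H.comp ⟨Prod.swap, continuous_swap⟩))
    (fun a => by ext t; exact hbot t a) (fun a b => by ext t; exact htop t a b)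
  refine ⟨⟨⟨fun p => k p.2 p.1, by fun_prop⟩, fun z => ?_, fun z => ?_⟩, fun t l => ?_⟩
  · rcases hc.surj z with ⟨l, rfl⟩ | ⟨a, s, rfl⟩
    · exact (DFunLike.congr_fun (hk1 l) 0).trans (hG0 l)
    · exact (DFunLike.congr_fun (hk2 a s) 0).trans (hH0 a s)
  · rcases hc.surj z with ⟨l, rfl⟩ | ⟨a, s, rfl⟩
    · exact (DFunLike.congr_fun (hk1 l) 1).trans (hG1 l)
    · exact (DFunLike.congr_fun (hk2 a s) 1).trans (hH1 a s)
  · exact DFunLike.congr_fun (hk1 l) t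

/-- Two cylinders with a common end are glued to a map from `A × ℝ`, constant near infinity. -/
theorem exists_line (κ P : C(A × I, Z)) (h : ∀ a, P (a, 0) = κ (a, 0)) :
    ∃ ℓ : C(A × ℝ, Z), (∀ a (w : ℝ) (hw : w ∈ I), ℓ (a, w) = κ (a, ⟨w, hw⟩)) ∧
      ∀ a (w : ℝ) (hw : -w ∈ I), ℓ (a, w) = P (a, ⟨-w, hw⟩) := by
  let pr : ℝ → I := Set.projIcc 0 1 zero_le_one
  have hpr : Continuous pr := continuous_projIcc
  have hpr0 : pr 0 = 0 := Set.projIcc_of_mem zero_le_one (x := 0) ⟨le_rfl, zero_le_one⟩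
  refine ⟨⟨fun p => if 0 ≤ p.2 then κ (p.1, pr p.2) else P (p.1, pr (-p.2)), ?_⟩, ?_, ?_⟩
  · refine Continuous.if_le (by fun_prop) (by fun_prop) continuous_const continuous_snd ?_
    rintro ⟨a, w⟩ hw
    obtain rfl : (0 : ℝ) = w := hw
    simp [hpr0, h]
  · intro a w hw
    have : pr w = ⟨w, hw⟩ := Set.projIcc_of_mem _ hw
    simp [hw.1, this]
  · intro a w hw
    have : pr (-w) = ⟨-w, hw⟩ := Set.projIcc_of_mem _ hw
    by_cases h0 : 0 ≤ w
    · obtain rfl : w = 0 := le_antisymm (by linarith [hw.1]) h0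
      simp [hpr0, h]
    · simp [h0, this]

variable {Z' : Type u} [TopologicalSpace Z']

/-- The map of mapping cones induced by a homotopy `f ≃ g`, in coordinates. -/
theorem IsCone.exists_map {f g : C(A, L)} {j : C(L, Z)} {κ : C(A × I, Z)} {j' : C(L, Z')}
    {κ' : C(A × I, Z')} (hc : IsCone f j κ) (hc' : IsCone g j' κ') (H : f.Homotopy g) :
    ∃ k : C(Z, Z'), (∀ l, k (j l) = j' l) ∧
      (∀ a (s : I) (hs : (2 * s - 1 : ℝ) ∈ I), k (κ (a, s)) = κ' (a, ⟨2 * s - 1, hs⟩)) ∧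
      ∀ a (s : I) (hs : (2 * s : ℝ) ∈ I), k (κ (a, s)) = j' (H (⟨2 * s, hs⟩, a)) := by
  -- The line runs through the track of `H` for `-1 ≤ w ≤ 0`, starting from `f` at `-1`, and through
  -- the cone for `0 ≤ w ≤ 1`. The map of cones sends height `s` to `w = 2s - 1`.
  obtain ⟨ℓ, hℓ1, hℓ2⟩ := exists_line κ' ⟨fun p : A × I => j' (H (σ p.2, p.1)), by fun_prop⟩
    (fun a => by simp [hc'.bot])
  obtain ⟨k, hk1, hk2⟩ := hc.desc j' ⟨fun p : A × I => ℓ (p.1, 2 * p.2 - 1), by fun_prop⟩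
    (fun a => by
      have h : -((2 * (0 : I) - 1 : ℝ)) ∈ I := by norm_num
      have h' : (⟨_, h⟩ : I) = 1 := by ext; norm_num
      simp only [ContinuousMap.coe_mk]
      rw [hℓ2 a _ h, h']
      simp)
    (fun a b => by
      have h : ((2 * (1 : I) - 1 : ℝ)) ∈ I := by norm_num
      have h' : (⟨_, h⟩ : I) = 1 := by ext; norm_num
      simp only [ContinuousMap.coe_mk]
      rw [hℓ1 a _ h, hℓ1 b _ h, h', hc'.top a b])
  refine ⟨k, hk1, fun a s hs => ?_, fun a s hs => ?_⟩
  · rw [hk2, ← hℓ1]; rfl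
  · have h : -((2 * s - 1 : ℝ)) ∈ I := ⟨by linarith [hs.2], by linarith [hs.1]⟩
    rw [hk2, ContinuousMap.coe_mk, hℓ2 a _ h]
    simp only [ContinuousMap.coe_mk]
    congr 3
    ext; simp

/-- The two maps of mapping cones induced by a homotopy and its inverse compose to a map homotopic
to the identity relative to `L`. -/
theorem IsCone.exists_homotopy_id {f g : C(A, L)} {j : C(L, Z)} {κ : C(A × I, Z)} {j' : C(L, Z')}
    {κ' : C(A × I, Z')} (hc : IsCone f j κ) (H : f.Homotopy g)
    {k : C(Z, Z')} (hk : ∀ l, k (j l) = j' l)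
    (hk1 : ∀ a (s : I) (hs : (2 * s - 1 : ℝ) ∈ I), k (κ (a, s)) = κ' (a, ⟨2 * s - 1, hs⟩))
    (hk2 : ∀ a (s : I) (hs : (2 * s : ℝ) ∈ I), k (κ (a, s)) = j' (H (⟨2 * s, hs⟩, a)))
    {m : C(Z', Z)} (hm : ∀ l, m (j' l) = j l)
    (hm1 : ∀ a (s : I) (hs : (2 * s - 1 : ℝ) ∈ I), m (κ' (a, s)) = κ (a, ⟨2 * s - 1, hs⟩))
    (hm2 : ∀ a (s : I) (hs : (2 * s : ℝ) ∈ I), m (κ' (a, s)) = j (H.symm (⟨2 * s, hs⟩, a))) :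
    ∃ F : (m.comp k).Homotopy (.id Z), ∀ t l, F (t, j l) = j l := by
  obtain ⟨ℓ, hℓ1, hℓ2⟩ := exists_line κ ⟨fun p : A × I => j (H (p.2, p.1)), by fun_prop⟩
    (fun a => by simp [hc.bot])
  -- On the cone the composite follows the line along `w = max (-2s) (4s - 3)`: out along `H` until
  -- `s = 1/2`, back along its inverse until `s = 3/4`, then up the cone. This path has the same
  -- ends `0` and `1` as `w = s`, so the straight-line homotopy between them fixes the base and the
  -- apex.
  refine hc.exists_homotopy ⟨fun p => j p.2, by fun_prop⟩
    ⟨fun p => ℓ (p.2.1, (1 - (p.1 : ℝ)) * max (-(2 * (p.2.2 : ℝ))) (4 * p.2.2 - 3) + p.1 * p.2.2),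
      by fun_prop⟩ ?_ ?_ ?_ ?_ ?_ ?_
  · intro t a
    have h : (1 - (t : ℝ)) * max (-(2 * ((0 : I) : ℝ))) (4 * (0 : I) - 3) + t * (0 : I) = 0 := by
      norm_num
    simp only [ContinuousMap.coe_mk]
    rw [h, hℓ1 a 0 ⟨le_rfl, zero_le_one⟩, ← hc.bot]
    rfl
  · intro t a b
    have h : (1 - (t : ℝ)) * max (-(2 * ((1 : I) : ℝ))) (4 * (1 : I) - 3) + t * (1 : I) = 1 := by
      norm_num
    simp only [ContinuousMap.coe_mk]
    rw [h, hℓ1 a 1 ⟨zero_le_one, le_rfl⟩, hℓ1 b 1 ⟨zero_le_one, le_rfl⟩]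
    exact hc.top a b
  · intro l; simp [hk, hm]
  · intro l; simp
  · intro a s
    have hs0 := s.2.1
    have hs1 := s.2.2
    simp only [ContinuousMap.coe_mk, ContinuousMap.comp_apply]
    rcases le_total (s : ℝ) (1 / 2) with h | h
    · rw [hk2 a s ⟨by linarith, by linarith⟩, hm]
      have e : (1 - ((0 : I) : ℝ)) * max (-(2 * (s : ℝ))) (4 * s - 3) + (0 : I) * s = -(2 * s) := by
        rw [max_eq_left (by linarith)]; simp
      rw [e, hℓ2 a _ ⟨by linarith, by linarith⟩]
      simp
    · rw [hk1 a s ⟨by linarith, by linarith⟩]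
      rcases le_total (s : ℝ) (3 / 4) with h' | h'
      · rw [hm2 a _ ⟨by simp; linarith, by simp; linarith⟩]
        have e : (1 - ((0 : I) : ℝ)) * max (-(2 * (s : ℝ))) (4 * s - 3) + (0 : I) * s
            = 4 * s - 3 := by rw [max_eq_right (by linarith)]; simp
        rw [e, hℓ2 a _ ⟨by linarith, by linarith⟩, ContinuousMap.Homotopy.symm_apply]
        simp only [ContinuousMap.coe_mk]
        congr 3; ext; simp; ring
      · rw [hm1 a _ ⟨by simp; linarith, by simp; linarith⟩]
        have e : (1 - ((0 : I) : ℝ)) * max (-(2 * (s : ℝ))) (4 * s - 3) + (0 : I) * s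
              = 4 * s - 3 := by rw [max_eq_right (by linarith)]; simp
        rw [e, hℓ1 a _ ⟨by linarith, by linarith⟩]
        congr 2; ext; simp; ring
  · intro a s
    have e : (1 - ((1 : I) : ℝ)) * max (-(2 * (s : ℝ))) (4 * s - 3) + (1 : I) * s = s := by simp
    simp only [ContinuousMap.coe_mk, ContinuousMap.id_apply]
    rw [e, hℓ1 a _ s.2]

/-- A mapping cone is contractible if both spaces it is made of are. -/
theorem IsCone.contractibleSpace {f : C(A, L)} {j : C(L, Z)} {κ : C(A × I, Z)} (hc : IsCone f j κ)
    [ContractibleSpace A] [ContractibleSpace L] : ContractibleSpace Z := by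
  obtain ⟨l₀, ⟨d⟩⟩ := id_nullhomotopic L
  obtain ⟨a₀, ⟨c⟩⟩ := id_nullhomotopic A
  obtain ⟨ℓ, hℓ1, hℓ2⟩ := exists_line κ ⟨fun p : A × I => j (d (p.2, f p.1)), by fun_prop⟩
    (fun a => by simp [hc.bot])
  have hm1 : ∀ a, ℓ (a, -1) = j l₀ := fun a => by
    rw [hℓ2 a (-1) (by norm_num)]
    simp
  have h1 : ∀ a, ℓ (a, 1) = κ (a, 1) := fun a => hℓ1 a 1 ⟨zero_le_one, le_rfl⟩
  have h0 : ∀ a, ℓ (a, 0) = j (f a) := fun a => by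
    rw [hℓ1 a 0 ⟨le_rfl, zero_le_one⟩, ← hc.bot]; rfl
  obtain ⟨k₁, hk11, hk12⟩ := hc.desc (.const L (j l₀))
    ⟨fun p : A × I => ℓ (p.1, 2 * p.2 - 1), by fun_prop⟩
    (fun a => by simp [hm1]) (fun a b => by
      have : (2 - 1 : ℝ) = 1 := by norm_num
      simp [this, h1, hc.top a b])
  obtain ⟨k₂, hk21, hk22⟩ := hc.desc (.const L (j l₀))
    ⟨fun p : A × I => ℓ (a₀, 2 * p.2 - 1), by fun_prop⟩
    (fun a => by simp [hm1]) (fun a b => by simp)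
  -- The contraction has three stages: `F₁` contracts `L` to `l₀` while the cone coordinate is
  -- stretched over `[-1, 1]`; `F₂` moves every ray of the cone to the ray over `a₀`; `F₃` pulls
  -- this ray back to its end at `-1`, which is `j l₀`.
  obtain ⟨F₁, -⟩ := hc.exists_homotopy (k₀ := .id Z) (k₁ := k₁)
    ⟨fun p => j (d p), by fun_prop⟩
    ⟨fun p => ℓ (p.2.1, p.2.2 - p.1 * (1 - p.2.2)), by fun_prop⟩
    (fun t a => by
      have h : -(0 - (t : ℝ) * (1 - 0)) ∈ I := by simp
      simp only [ContinuousMap.coe_mk]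
      rw [Set.Icc.coe_zero, hℓ2 a _ h]
      simp)
    (fun t a b => by simp [h1, hc.top a b]) (fun l => by simp) (fun l => by simp [hk11])
    (fun a s => by
      simp only [ContinuousMap.coe_mk, Set.Icc.coe_zero, zero_mul, sub_zero]
      rw [hℓ1 a _ s.2]; rfl)
    (fun a s => by
      rw [hk12]
      simp only [ContinuousMap.coe_mk, Set.Icc.coe_one]
      congr 2; ring)
  obtain ⟨F₂, -⟩ := hc.exists_homotopy (k₀ := k₁) (k₁ := k₂)
    (.const _ (j l₀)) ⟨fun p => ℓ (c (p.1, p.2.1), 2 * p.2.2 - 1), by fun_prop⟩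
    (fun t a => by simp [hm1])
    (fun t a b => by
      have : (2 - 1 : ℝ) = 1 := by norm_num
      simp only [ContinuousMap.coe_mk, Set.Icc.coe_one, mul_one, this, h1]
      exact hc.top _ _)
    (fun l => by simp [hk11]) (fun l => by simp [hk21])
    (fun a s => by simp [hk12]) (fun a s => by simp [hk22])
  obtain ⟨F₃, -⟩ := hc.exists_homotopy (k₀ := k₂) (k₁ := .const Z (j l₀))
    (.const _ (j l₀)) ⟨fun p => ℓ (a₀, 2 * ((1 - p.1) * p.2.2) - 1), by fun_prop⟩
    (fun t a => by simp [hm1]) (fun t a b => by simp) (fun l => by simp [hk21]) (fun l => by simp)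
    (fun a s => by simp [hk22]) (fun a s => by simp [hm1])
  exact (contractible_iff_id_nullhomotopic Z).2 ⟨j l₀, ⟨(F₁.trans F₂).trans F₃⟩⟩

/-- A criterion for mapping cones of compact spaces. -/
theorem IsCone.of_compact [CompactSpace A] [CompactSpace L] [T2Space Z] [Nonempty A]
    {f : C(A, L)} {j : C(L, Z)} {κ : C(A × I, Z)}
    (bot : ∀ a, κ (a, 0) = j (f a)) (top : ∀ a b, κ (a, 1) = κ (b, 1))
    (surj : ∀ z, (∃ l, j l = z) ∨ ∃ a s, κ (a, s) = z) (hj : Function.Injective j)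
    (hjκ : ∀ l a s, j l = κ (a, s) → s = 0)
    (hκ : ∀ a s b t, κ (a, s) = κ (b, t) → s = t ∧ (s = 1 ∨ a = b)) : IsCone f j κ where
  bot := bot
  top := top
  surj := surj
  desc {T} _ g h hg hh := by
    let q : C(L ⊕ (A × I), Z) := ⟨Sum.elim j κ, by fun_prop⟩
    have hq : Topology.IsQuotientMap q := by
      refine Topology.IsQuotientMap.of_surjective_continuous (fun z => ?_) q.continuous
      rcases surj z with ⟨l, hl⟩ | ⟨a, s, h⟩
      · exact ⟨Sum.inl l, hl⟩
      · exact ⟨Sum.inr (a, s), h⟩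
    have key : ∀ l a s, j l = κ (a, s) → g l = h (a, s) := by
      intro l a s hl
      obtain rfl := hjκ l a s hl
      rw [bot] at hl
      rw [hg, hj hl]
    let m : C(L ⊕ (A × I), T) := ⟨Sum.elim g h, by fun_prop⟩
    have hm : Function.FactorsThrough m q := by
      rintro (l | ⟨a, s⟩) (l' | ⟨b, t⟩) e
      · exact congrArg g (hj e)
      · exact key _ _ _ e
      · exact (key _ _ _ (Eq.symm e)).symm
      · obtain ⟨rfl, rfl | rfl⟩ := hκ _ _ _ _ e
        · exact hh _ _
        · rfl
    exact ⟨hq.lift m hm, fun l => DFunLike.congr_fun (hq.lift_comp m hm) (Sum.inl l),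
      fun a s => DFunLike.congr_fun (hq.lift_comp m hm) (Sum.inr (a, s))⟩

/-- The base of a mapping cone can be replaced by a homeomorphic space. -/
theorem IsCone.comp_homeomorph {B : Type u} [TopologicalSpace B] {f : C(A, L)} {j : C(L, Z)}
    {κ : C(A × I, Z)} (hc : IsCone f j κ) (φ : B ≃ₜ A) :
    IsCone (f.comp ⟨φ, φ.continuous⟩) j ⟨fun p : B × I => κ (φ p.1, p.2), by fun_prop⟩ where
  bot b := hc.bot _
  top b c := hc.top _ _
  surj z := by
    rcases hc.surj z with ⟨l, hl⟩ | ⟨a, s, h⟩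
    · exact Or.inl ⟨l, hl⟩
    · exact Or.inr ⟨φ.symm a, s, by simpa using h⟩
  desc g h hg hh := by
    obtain ⟨k, hk1, hk2⟩ := hc.desc g ⟨fun p => h (φ.symm p.1, p.2), by fun_prop⟩
      (fun a => by simp [hg]) (fun a b => hh _ _)
    exact ⟨k, hk1, fun b s => by simp [hk2]⟩

end Cones

/-! ### Pointed homotopy equivalences -/

section Pointed

variable {X Y W : Type u} [TopologicalSpace X] [TopologicalSpace Y] [TopologicalSpace W]

/-- The pointed spaces `(X, x)` and `(Y, y)` are homotopy equivalent as pointed spaces. -/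
def PtdEquiv (x : X) (y : Y) : Prop :=
  ∃ (f : C(X, Y)) (g : C(Y, X)), f x = y ∧ g y = x ∧
    (g.comp f).HomotopicRel (.id X) {x} ∧ (f.comp g).HomotopicRel (.id Y) {y}

theorem homotopicRel_singleton {f g : C(X, Y)} {x : X} (F : f.Homotopy g)
    (h : ∀ t, F (t, x) = f x) : f.HomotopicRel g {x} :=
  ⟨⟨F, by rintro t _ rfl; exact h t⟩⟩

theorem homotopicRel_comp_singleton {f g : C(Y, W)} {y : Y} (h : f.HomotopicRel g {y})
    (k : C(X, Y)) {x : X} (hk : k x = y) : (f.comp k).HomotopicRel (g.comp k) {x} := by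
  obtain ⟨F⟩ := h
  refine homotopicRel_singleton (F.toHomotopy.comp (ContinuousMap.Homotopy.refl k)) fun t => ?_
  exact F.eq_fst t hk

theorem PtdEquiv.trans {x : X} {y : Y} {w : W} (h : PtdEquiv x y) (h' : PtdEquiv y w) :
    PtdEquiv x w := by
  obtain ⟨f, g, hf, hg, h1, h2⟩ := h
  obtain ⟨f', g', hf', hg', h1', h2'⟩ := h'
  refine ⟨f'.comp f, g.comp g', by simp [hf, hf'], by simp [hg, hg'], ?_, ?_⟩
  · exact (((homotopicRel_comp_singleton h1' f hf).comp_continuousMap g)).trans h1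
  · exact (((homotopicRel_comp_singleton h2 g' hg').comp_continuousMap f')).trans h2'

theorem PtdEquiv.of_inverse {x : X} {y : Y} (f : C(X, Y)) (g : C(Y, X)) (hf : f x = y)
    (h1 : ∀ x, g (f x) = x) (h2 : ∀ y, f (g y) = y) : PtdEquiv x y := by
  refine ⟨f, g, hf, by rw [← hf, h1], ?_, ?_⟩
  · rw [show g.comp f = .id X from ContinuousMap.ext h1]
    exact .refl _
  · rw [show f.comp g = .id Y from ContinuousMap.ext h2]
    exact .refl _

theorem PtdEquiv.of_homeomorph (φ : X ≃ₜ Y) (x : X) : PtdEquiv x (φ x) :=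
  .of_inverse ⟨φ, φ.continuous⟩ ⟨φ.symm, φ.symm.continuous⟩ rfl (by simp) (by simp)

theorem PtdEquiv.nonempty_homotopyEquiv {x : X} {y : Y} (h : PtdEquiv x y) :
    Nonempty (ContinuousMap.HomotopyEquiv X Y) := by
  obtain ⟨f, g, -, -, h1, h2⟩ := h
  exact ⟨⟨f, g, h1.homotopic, h2.homotopic⟩⟩

/-- Mapping cones of homotopic maps are homotopy equivalent relative to the target of the maps. -/
theorem IsCone.ptdEquiv {A L Z Z' : Type u} [TopologicalSpace A] [TopologicalSpace L]
    [TopologicalSpace Z] [TopologicalSpace Z'] {f g : C(A, L)} {j : C(L, Z)} {κ : C(A × I, Z)}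
    {j' : C(L, Z')} {κ' : C(A × I, Z')} (hc : IsCone f j κ) (hc' : IsCone g j' κ')
    (h : f.Homotopic g) (l : L) : PtdEquiv (j l) (j' l) := by
  obtain ⟨H⟩ := h
  obtain ⟨k, hk, hk1, hk2⟩ := hc.exists_map hc' H
  obtain ⟨m, hm, hm1, hm2⟩ := hc'.exists_map hc H.symm
  obtain ⟨F, hF⟩ := hc.exists_homotopy_id H hk hk1 hk2 hm hm1 hm2
  obtain ⟨F', hF'⟩ := hc'.exists_homotopy_id H.symm hm hm1 hm2 hk hk1 (by simpa using hk2)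
  exact ⟨k, m, hk l, hm l, homotopicRel_singleton F fun t => by simp [hF, hk, hm],
    homotopicRel_singleton F' fun t => by simp [hF', hk, hm]⟩

end Pointed

/-! ### Suspensions and wedges -/

section Wedges

variable {X : Type u} [TopologicalSpace X]

/-- The quotient map from the cylinder to the suspension. -/
def Susp.mk (X : Type u) [TopologicalSpace X] : C(X × I, Susp X) :=
  ⟨fun p => Quot.mk _ (Sum.inl p), continuous_quot_mk.comp continuous_inl⟩

/-- The second pole of the suspension. -/
def Susp.pole' (X : Type u) [TopologicalSpace X] : Susp X := Quot.mk _ (Sum.inr true)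

theorem Susp.mk_zero (x : X) : Susp.mk X (x, 0) = Susp.pole X := Quot.sound (SuspRel.bot x)

theorem Susp.mk_one (x : X) : Susp.mk X (x, 1) = Susp.pole' X := Quot.sound (SuspRel.top x)

theorem Susp.ind {P : Susp X → Prop} (h0 : P (Susp.pole X)) (h1 : P (Susp.pole' X))
    (h : ∀ x t, P (Susp.mk X (x, t))) (z : Susp X) : P z := by
  obtain ⟨⟨x, t⟩ | b, rfl⟩ := Quot.exists_rep z
  · exact h x t
  · cases b
    · exact h0
    · exact h1

instance [CompactSpace X] : CompactSpace (Susp X) :=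
  inferInstanceAs (CompactSpace (Quot (SuspRel X)))

theorem Susp.exists_desc {T : Type*} [TopologicalSpace T] (h : C(X × I, T)) (a b : T)
    (h0 : ∀ x, h (x, 0) = a) (h1 : ∀ x, h (x, 1) = b) :
    ∃ k : C(Susp X, T), k (Susp.pole X) = a ∧ k (Susp.pole' X) = b ∧
      ∀ x t, k (Susp.mk X (x, t)) = h (x, t) := by
  refine ⟨⟨Quot.lift (Sum.elim h fun c => bif c then b else a) ?_, ?_⟩, rfl, rfl, fun x t => rfl⟩
  · rintro _ _ (x | x)
    · exact h0 x
    · exact h1 x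
  · exact continuous_quot_lift _ (by fun_prop)

variable {ι : Type} {Y : ι → Type u} [∀ i, TopologicalSpace (Y i)]

/-- The inclusion of the first summand into the wedge. -/
def Wedge.inl (p : X) (q : ∀ i, Y i) : C(X, Wedge p q) :=
  ⟨fun x => Quot.mk _ (Sum.inl x), continuous_quot_mk.comp continuous_inl⟩

/-- The inclusion of the `i`-th further summand into the wedge. -/
def Wedge.inr (p : X) (q : ∀ i, Y i) (i : ι) : C(Y i, Wedge p q) :=
  ⟨fun y => Quot.mk _ (Sum.inr ⟨i, y⟩),
    continuous_quot_mk.comp (continuous_inr.comp continuous_sigmaMk)⟩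

theorem Wedge.glue (p : X) (q : ∀ i, Y i) (i : ι) : Wedge.inr p q i (q i) = Wedge.inl p q p :=
  Quot.sound (WedgeRel.glue i)

theorem Wedge.ind {p : X} {q : ∀ i, Y i} {P : Wedge p q → Prop} (h0 : ∀ x, P (Wedge.inl p q x))
    (h1 : ∀ i y, P (Wedge.inr p q i y)) (z : Wedge p q) : P z := by
  obtain ⟨x | ⟨i, y⟩, rfl⟩ := Quot.exists_rep z
  · exact h0 x
  · exact h1 i y

theorem Wedge.exists_desc {T : Type*} [TopologicalSpace T] {p : X} {q : ∀ i, Y i} (g : C(X, T))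
    (h : ∀ i, C(Y i, T)) (hgh : ∀ i, h i (q i) = g p) :
    ∃ k : C(Wedge p q, T), (∀ x, k (Wedge.inl p q x) = g x) ∧
      ∀ i y, k (Wedge.inr p q i y) = h i y := by
  refine ⟨⟨Quot.lift (Sum.elim g fun y => h y.1 y.2) ?_, ?_⟩, fun x => rfl, fun i y => rfl⟩
  · rintro _ _ ⟨i⟩
    exact hgh i
  · refine continuous_quot_lift _ (continuous_sumElim.2 ⟨g.continuous, ?_⟩)
    exact continuous_sigma fun i => (h i).continuous

/-- A pointed self-map of a wedge is homotopic to the identity if it is the identity on all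
summands but the first and homotopic to the identity on the first. -/
theorem Wedge.homotopicRel_id {p : X} {q : ∀ i, Y i} {k : C(X, X)}
    (hk : k.HomotopicRel (.id X) {p}) {m : C(Wedge p q, Wedge p q)}
    (hm1 : ∀ x, m (Wedge.inl p q x) = Wedge.inl p q (k x))
    (hm2 : ∀ i y, m (Wedge.inr p q i y) = Wedge.inr p q i y) :
    m.HomotopicRel (.id _) {Wedge.inl p q p} := by
  obtain ⟨F⟩ := hk
  have hF : ∀ t, F (t, p) = p := fun t => F.eq_snd t rfl
  obtain ⟨K, hK1, hK2⟩ := Wedge.exists_desc (p := p) (q := q) (T := C(I, Wedge p q))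
    (ContinuousMap.curry ⟨fun z : X × I => Wedge.inl p q (F (z.2, z.1)), by fun_prop⟩)
    (fun i => ContinuousMap.curry ⟨fun z : Y i × I => Wedge.inr p q i z.1, by fun_prop⟩)
    (fun i => by ext t; simp [hF, Wedge.glue])
  refine homotopicRel_singleton ⟨⟨fun z => K z.2 z.1, by fun_prop⟩, ?_, ?_⟩ ?_
  · exact Wedge.ind (fun x => by simp [hK1, hm1]) fun i y => by simp [hK2, hm2]
  · exact Wedge.ind (fun x => by simp [hK1]) fun i y => by simp [hK2]
  · intro t
    have hkp : k p = p := by have := F.fst_eq_snd (Set.mem_singleton p); simpa using this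
    have : K (Wedge.inl p q p) t = Wedge.inl p q (F (t, p)) := by rw [hK1]; rfl
    exact this.trans (by rw [hm1, hF, hkp])

theorem PtdEquiv.wedge {X' : Type u} [TopologicalSpace X'] {p : X} {p' : X'} (q : ∀ i, Y i)
    (h : PtdEquiv p p') : PtdEquiv (Wedge.inl p q p) (Wedge.inl p' q p') := by
  obtain ⟨f, g, hf, hg, h1, h2⟩ := h
  obtain ⟨F, hF1, hF2⟩ := Wedge.exists_desc (p := p) (q := q) ((Wedge.inl p' q).comp f)
    (Wedge.inr p' q) (fun i => by simp [hf, Wedge.glue])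
  obtain ⟨G, hG1, hG2⟩ := Wedge.exists_desc (p := p') (q := q) ((Wedge.inl p q).comp g)
    (Wedge.inr p q) (fun i => by simp [hg, Wedge.glue])
  exact ⟨F, G, by simp [hF1, hf], by simp [hG1, hg],
    Wedge.homotopicRel_id h1 (by simp [hF1, hG1]) (by simp [hF2, hG2]),
    Wedge.homotopicRel_id h2 (by simp [hF1, hG1]) (by simp [hF2, hG2])⟩

theorem PtdEquiv.wedge_isEmpty [IsEmpty ι] (p : X) (q : ∀ i, Y i) :
    PtdEquiv p (Wedge.inl p q p) := by
  obtain ⟨k, hk, -⟩ := Wedge.exists_desc (p := p) (q := q) (.id X) (fun i => isEmptyElim i)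
    (fun i => isEmptyElim i)
  exact .of_inverse (Wedge.inl p q) k rfl hk
    (Wedge.ind (fun x => by rw [hk]; rfl) fun i => isEmptyElim i)

/-- Successive splittings produce nested wedges with the summand split off first outermost; this
flattens one level of nesting. -/
theorem PtdEquiv.wedge_succ {k : ℕ} {Y : Fin (k + 1) → Type u} [∀ i, TopologicalSpace (Y i)]
    (p : X) (q : ∀ i, Y i) :
    PtdEquiv (Wedge.inl (Wedge.inl p (fun i : Fin k => q i.succ) p) (fun _ : Unit => q 0)
      (Wedge.inl p (fun i : Fin k => q i.succ) p)) (Wedge.inl p q p) := by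
  obtain ⟨a, ha1, ha2⟩ := Wedge.exists_desc (p := p) (q := fun i : Fin k => q i.succ)
    (Wedge.inl p q) (fun i => Wedge.inr p q i.succ) (fun i => Wedge.glue p q i.succ)
  obtain ⟨b, hb1, hb2⟩ := Wedge.exists_desc (p := Wedge.inl p (fun i : Fin k => q i.succ) p)
    (q := fun _ : Unit => q 0) a (fun _ => Wedge.inr p q 0)
    (fun i => by rw [ha1]; exact Wedge.glue p q 0)
  let w := Wedge.inl (Wedge.inl p (fun i : Fin k => q i.succ) p) (fun _ : Unit => q 0)
  obtain ⟨c, hc1, hc2⟩ := Wedge.exists_desc (p := p) (q := q)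
    (w.comp (Wedge.inl p (fun i : Fin k => q i.succ)))
    (fun i => Fin.cases (motive := fun i => C(Y i, _)) (Wedge.inr _ (fun _ : Unit => q 0) ())
      (fun i => w.comp (Wedge.inr p (fun i : Fin k => q i.succ) i)) i)
    (fun i => by
      refine Fin.cases ?_ (fun i => ?_) i
      · exact Wedge.glue _ (fun _ : Unit => q 0) ()
      · exact congrArg w (Wedge.glue p (fun i : Fin k => q i.succ) i))
  refine .of_inverse b c (by rw [hb1, ha1]) (Wedge.ind (Wedge.ind ?_ ?_) ?_) (Wedge.ind ?_ ?_)
  · intro x; rw [hb1, ha1, hc1]; rfl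
  · intro i y; rw [hb1, ha2, hc2]; rfl
  · intro i y; rw [hb2, hc2]; rfl
  · intro x; rw [hc1]; exact (hb1 _).trans (ha1 x)
  · intro i
    refine Fin.cases ?_ (fun i => ?_) i
    · intro y; rw [hc2]; exact hb2 _ _
    · intro y; rw [hc2]; exact (hb1 _).trans (ha2 i y)

/-- A sequence of splittings off of wedge summands. -/
theorem PtdEquiv.wedge_of_forall {k : ℕ} (X : ℕ → Type u) [∀ i, TopologicalSpace (X i)]
    (x : ∀ i, X i) (Y : Fin k → Type u) [∀ i, TopologicalSpace (Y i)] (q : ∀ i, Y i)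
    (h : ∀ i : Fin k, PtdEquiv (x i)
      (Wedge.inl (x (i + 1)) (fun _ : Unit => q i) (x (i + 1)))) :
    PtdEquiv (x 0) (Wedge.inl (x k) q (x k)) := by
  induction k generalizing X with
  | zero => exact .wedge_isEmpty _ _
  | succ k ih =>
    have := ih (fun i => X (i + 1)) (fun i => x (i + 1)) (fun i => Y i.succ) (fun i => q i.succ)
      (fun i => h i.succ)
    -- The inductive equivalence is used inside the first summand of a wedge, which is possible
    -- because it is pointed.
    exact (h 0).trans ((this.wedge _).trans (.wedge_succ _ q))

/-- The mapping cone of a constant map is the wedge with a suspension. -/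
theorem isCone_wedge (A : Type u) [TopologicalSpace A] [Nonempty A] (p : X) :
    IsCone (.const A p) (Wedge.inl p fun _ : Unit => Susp.pole A)
      ((Wedge.inr p (fun _ : Unit => Susp.pole A) ()).comp (Susp.mk A)) where
  bot a := by
    simp only [ContinuousMap.comp_apply, Susp.mk_zero]
    exact Wedge.glue p (fun _ : Unit => Susp.pole A) ()
  top a b := by simp [Susp.mk_one]
  surj := by
    obtain ⟨a⟩ := ‹Nonempty A›
    refine Wedge.ind (fun x => Or.inl ⟨x, rfl⟩) fun i => Susp.ind ?_ ?_ ?_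
    · exact Or.inl ⟨p, (Wedge.glue p (fun _ : Unit => Susp.pole A) ()).symm⟩
    · exact Or.inr ⟨a, 1, by simp [Susp.mk_one]⟩
    · exact fun a t => Or.inr ⟨a, t, rfl⟩
  desc g h hg hh := by
    obtain ⟨a⟩ := ‹Nonempty A›
    obtain ⟨m, hm0, -, hm⟩ := Susp.exists_desc h (g p) (h (a, 1)) hg (fun b => hh b a)
    obtain ⟨k, hk1, hk2⟩ := Wedge.exists_desc (q := fun _ : Unit => Susp.pole A) g (fun _ => m)
      (fun _ => hm0)
    exact ⟨k, hk1, fun a s => (hk2 () _).trans (hm a s)⟩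

end Wedges

end IndCplx

namespace IndCplx

universe u

/-! ### Induced independence complexes inside a fixed space of weights -/

/-- The inclusion of a subspace into a larger one. -/
def inclMap {E : Type*} [TopologicalSpace E] {s t : Set E} (h : s ⊆ t) : C(s, t) :=
  ⟨Set.inclusion h, continuous_inclusion h⟩

theorem nullhomotopic_inclMap {E : Type*} [TopologicalSpace E] {s t t' : Set E} (h : s ⊆ t)
    (h' : t ⊆ t') [ContractibleSpace t] : (inclMap (h.trans h')).Nullhomotopic := by
  obtain ⟨c, ⟨F⟩⟩ := id_nullhomotopic t
  exact ⟨inclMap h' c, ⟨((ContinuousMap.Homotopy.refl (inclMap h')).comp F).comp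
    (ContinuousMap.Homotopy.refl (inclMap h))⟩⟩

/-- Supplies the compatibility condition of `mix_mem_indSet` when one of the two points is a vertex.
-/
theorem single_adj {V : Type*} [DecidableEq V] {G : SimpleGraph V} {x : V → ℝ} {v : V} (h : ∀ w, G.Adj v w → x w = 0) (a b : V)
    (hab : G.Adj a b) : x a = 0 ∨ (Pi.single v 1 : V → ℝ) b = 0 := by
  by_cases hb : b = v
  · subst hb; exact Or.inl (h a hab.symm)
  · exact Or.inr (Pi.single_eq_of_ne hb _)

/-- A criterion for mapping cones made of straight lines, by means of the height function `φ`. -/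
theorem isCone_linear {V : Type u} {A L Z : Set (V → ℝ)} {b : V → ℝ} (φ : (V → ℝ) → ℝ) (hA : IsCompact A)
    (hL : IsCompact L) (hne : A.Nonempty) (hAL : A ⊆ L) (hLZ : L ⊆ Z)
    (hκ : ∀ a ∈ A, ∀ s ∈ I, (1 - s) • a + s • b ∈ Z) (hφL : ∀ l ∈ L, φ l = 0)
    (hφ : ∀ a ∈ A, ∀ s ∈ I, φ ((1 - s) • a + s • b) = s)
    (surj : ∀ z ∈ Z, z ∈ L ∨ ∃ a ∈ A, ∃ s ∈ I, (1 - s) • a + s • b = z) :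
    IsCone (inclMap hAL) (inclMap hLZ) ⟨fun p : A × I =>
      ⟨(1 - (p.2 : ℝ)) • p.1.1 + (p.2 : ℝ) • b, hκ _ p.1.2 _ p.2.2⟩, by fun_prop⟩ := by
  have := isCompact_iff_compactSpace.1 hA
  have := isCompact_iff_compactSpace.1 hL
  have := hne.to_subtype
  refine IsCone.of_compact ?_ ?_ ?_ ?_ ?_ ?_
  · intro a; ext; simp [inclMap]
  · intro a b; ext; simp
  · rintro ⟨z, hz⟩
    rcases surj z hz with h | ⟨a, ha, s, hs, h⟩
    · exact Or.inl ⟨⟨z, h⟩, rfl⟩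
    · exact Or.inr ⟨⟨a, ha⟩, ⟨s, hs⟩, Subtype.ext h⟩
  · exact Set.inclusion_injective hLZ
  · rintro ⟨l, hl⟩ ⟨a, ha⟩ ⟨s, hs⟩ h
    have h' : l = (1 - s) • a + s • b := congrArg Subtype.val h
    have := hφ a ha s hs
    rw [← h', hφL l hl] at this
    exact Subtype.ext this.symm
  · rintro ⟨a, ha⟩ ⟨s, hs⟩ ⟨a', ha'⟩ ⟨t, ht⟩ h
    have h' : (1 - s) • a + s • b = (1 - t) • a' + t • b := congrArg Subtype.val h
    have := hφ a ha s hs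
    rw [h', hφ a' ha' t ht] at this
    subst this
    refine ⟨rfl, ?_⟩
    by_cases h1 : t = 1
    · exact Or.inl (Subtype.ext h1)
    · refine Or.inr (Subtype.ext ?_)
      have := add_right_cancel h'
      exact smul_right_injective _ (sub_ne_zero.2 (Ne.symm h1)) this

section IndSet

variable {V : Type u} [Fintype V]

/-- The realization of `Ind(G[U])`, as a space of weights on all vertices of `G`. -/
def indSet (G : SimpleGraph V) (U : Set V) : Set (V → ℝ) :=
  {x | (∀ v, 0 ≤ x v) ∧ (∀ v ∉ U, x v = 0) ∧ (∀ a b, G.Adj a b → x a = 0 ∨ x b = 0) ∧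
    ∑ v, x v = 1}

variable {G : SimpleGraph V} {U : Set V}

theorem indSet_mono {U' : Set V} (h : U ⊆ U') : indSet G U ⊆ indSet G U' :=
  fun _ hx => ⟨hx.1, fun v hv => hx.2.1 v fun h' => hv (h h'), hx.2.2⟩

theorem indSet_anti {G' : SimpleGraph V} (h : G' ≤ G) : indSet G U ⊆ indSet G' U :=
  fun _ hx => ⟨hx.1, hx.2.1, fun a b hab => hx.2.2.1 a b (h hab), hx.2.2.2⟩

theorem le_one_of_mem_indSet {x : V → ℝ} (hx : x ∈ indSet G U) (v : V) : x v ≤ 1 :=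
  hx.2.2.2 ▸ Finset.single_le_sum (fun w _ => hx.1 w) (Finset.mem_univ v)

theorem add_le_one_of_mem_indSet {x : V → ℝ} (hx : x ∈ indSet G U) {v w : V} (h : v ≠ w) :
    x v + x w ≤ 1 := by
  classical
  rw [← Finset.sum_pair h, ← hx.2.2.2]
  exact Finset.sum_le_sum_of_subset_of_nonneg (Finset.subset_univ _) fun w _ _ => hx.1 w

theorem isCompact_indSet (G : SimpleGraph V) (U : Set V) : IsCompact (indSet G U) := by
  have hb : indSet G U ⊆ Set.Icc 0 1 := fun x hx => ⟨hx.1, le_one_of_mem_indSet hx⟩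
  refine isCompact_Icc.of_isClosed_subset ?_ hb
  simp only [indSet, Set.ofPred_and, Set.ofPred_forall, Set.ofPred_or]
  refine .inter (isClosed_iInter fun v => isClosed_le (by fun_prop) (by fun_prop))
    (.inter (isClosed_iInter fun v => isClosed_iInter fun _ => isClosed_eq (by fun_prop)
      (by fun_prop)) (.inter (isClosed_iInter fun a => isClosed_iInter fun b =>
        isClosed_iInter fun _ => .union (isClosed_eq (by fun_prop) (by fun_prop))
          (isClosed_eq (by fun_prop) (by fun_prop))) (isClosed_eq (by fun_prop) (by fun_prop))))

instance : CompactSpace (indSet G U) := isCompact_iff_compactSpace.1 (isCompact_indSet G U)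

/-- The face required by `realizationSet` can be taken to be the support of `x`. Independence is a
condition on pairs, hence on the coordinates of `x`, and the total weight `1` makes the support
nonempty. -/
theorem mem_realizationSet_ind {x : V → ℝ} : x ∈ realizationSet (Ind G) ↔
    (∀ v, 0 ≤ x v) ∧ (∀ a b, G.Adj a b → x a = 0 ∨ x b = 0) ∧ ∑ v, x v = 1 := by
  classical
  constructor
  · rintro ⟨h0, s, ⟨-, hs⟩, hz, h1⟩
    refine ⟨h0, fun a b hab => ?_, ?_⟩
    · by_contra! h
      have ha : a ∈ s := by_contra fun ha => h.1 (hz a ha)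
      have hb : b ∈ s := by_contra fun hb => h.2 (hz b hb)
      exact hs ha hb hab.ne hab
    · rw [← h1]
      exact (Finset.sum_subset (Finset.subset_univ s) fun v _ hv => hz v hv).symm
  · rintro ⟨h0, h, h1⟩
    refine ⟨h0, Finset.univ.filter fun v => x v ≠ 0, ⟨?_, ?_⟩, by simp, ?_⟩
    · rw [Finset.nonempty_iff_ne_empty]
      intro he
      have : ∑ v, x v = 0 := Finset.sum_eq_zero fun v _ => by
        by_contra hv
        have : v ∈ Finset.univ.filter fun v => x v ≠ 0 := by simp [hv]
        simp [he] at this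
      linarith
    · intro a ha b hb _ hab
      simp only [Finset.coe_filter, Finset.mem_univ, true_and, Set.mem_ofPred_eq] at ha hb
      exact (h a b hab).elim ha hb
    · rw [← h1]
      exact Finset.sum_filter_of_ne fun v _ hv => hv

theorem indSet_univ (G : SimpleGraph V) : indSet G Set.univ = realizationSet (Ind G) := by
  ext x
  simp [mem_realizationSet_ind, indSet]

theorem extend_mem_indSet (x : Realization (Ind (G.induce U))) :
    Function.extend ((↑) : U → V) x.1 0 ∈ indSet G U := by
  have h := extend_mem_realizationSet G U x.1 x.2
  rw [mem_realizationSet_ind] at h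
  refine ⟨h.1, fun v hv => ?_, h.2⟩
  rw [Function.extend_apply' _ _ _ (by simpa using hv)]
  rfl

theorem restrict_mem_realizationSet {y : V → ℝ} (hy : y ∈ indSet G U) :
    (fun v : U => y v) ∈ realizationSet (Ind (G.induce U)) := by
  classical
  rw [mem_realizationSet_ind]
  refine ⟨fun v => hy.1 v, fun a b hab => hy.2.2.1 a b hab, ?_⟩
  rw [← hy.2.2.2, ← Finset.sum_filter_of_ne (p := (· ∈ U))
    fun v _ hv => by_contra fun h => hv (hy.2.1 v h)]
  exact (Finset.sum_subtype (Finset.univ.filter (· ∈ U)) (by simp) y).symm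

/-- The realization of `Ind(G[U])` is homeomorphic to `indSet G U`. -/
noncomputable def realizationHomeomorph (G : SimpleGraph V) (U : Set V) :
    Realization (Ind (G.induce U)) ≃ₜ indSet G U where
  toFun x := ⟨Function.extend ((↑) : U → V) x.1 0, extend_mem_indSet x⟩
  invFun y := ⟨fun v => y.1 v, restrict_mem_realizationSet y.2⟩
  left_inv x := by
    ext v
    exact Subtype.val_injective.extend_apply x.1 0 v
  right_inv y := by
    ext v
    by_cases hv : v ∈ U
    · exact Subtype.val_injective.extend_apply (fun w : U => y.1 w) (0 : V → ℝ) ⟨v, hv⟩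
    · exact ((extend_mem_indSet _).2.1 v hv).trans (y.2.2.1 v hv).symm
  continuous_toFun :=
    (continuous_subtype_val.comp (indInclusion G U).continuous).subtype_mk _
  continuous_invFun :=
    Continuous.subtype_mk
      (continuous_pi fun v => (continuous_apply v.1).comp continuous_subtype_val) _

theorem nullhomotopic_indInclusion {S : Set V} (hS : S ⊆ U) [ContractibleSpace (indSet G U)] :
    (indInclusion G S).Nullhomotopic := by
  have h := nullhomotopic_inclMap (indSet_mono (G := G) hS) (indSet_mono (Set.subset_univ U))
  obtain ⟨c, ⟨F⟩⟩ := h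
  let e : C(Realization (Ind (G.induce S)), indSet G S) := realizationHomeomorph G S
  let d : C(indSet G Set.univ, Realization (Ind G)) := inclMap (indSet_univ G).subset
  exact ⟨d c, ⟨((ContinuousMap.Homotopy.refl d).comp F).comp (ContinuousMap.Homotopy.refl e)⟩⟩

/-- The condition `h` says that the union of the supports of `x` and `y` is independent, so that the
whole segment lies in one face. All homotopies and cone coordinates on `indSet` are built from such
segments. -/
theorem mix_mem_indSet {x y : V → ℝ} (hx : x ∈ indSet G U) (hy : y ∈ indSet G U)
    (h : ∀ a b, G.Adj a b → x a = 0 ∨ y b = 0) {s : ℝ} (hs : s ∈ I) :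
    (1 - s) • x + s • y ∈ indSet G U := by
  refine ⟨fun v => ?_, fun v hv => by simp [hx.2.1 v hv, hy.2.1 v hv], fun a b hab => ?_, ?_⟩
  · have h1 := mul_nonneg (sub_nonneg.2 hs.2) (hx.1 v)
    have h2 := mul_nonneg hs.1 (hy.1 v)
    simpa using add_nonneg h1 h2
  · have h1 := hx.2.2.1 a b hab
    have h2 := hy.2.2.1 a b hab
    have h3 := h a b hab
    have h4 := h b a hab.symm
    -- If `x` or `y` is nonzero at `a`, then both vanish at `b`.
    have h5 : (x a = 0 ∧ y a = 0) ∨ (x b = 0 ∧ y b = 0) := by tauto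
    rcases h5 with h5 | h5 <;> simp [h5.1, h5.2]
  · simp [Finset.sum_add_distrib, ← Finset.mul_sum, hx.2.2.2, hy.2.2.2]

variable [DecidableEq V]

theorem single_mem_indSet {v : V} (hv : v ∈ U) : Pi.single v 1 ∈ indSet G U := by
  refine ⟨fun w => ?_, fun w hw => ?_, fun a b hab => ?_, by simp⟩
  · by_cases h : w = v
    · subst h; simp
    · simp [h]
  · refine Pi.single_eq_of_ne ?_ _
    rintro rfl
    exact hw hv
  · by_contra! h
    have ha : a = v := by_contra fun ha => h.1 (Pi.single_eq_of_ne ha _)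
    have hb : b = v := by_contra fun hb => h.2 (Pi.single_eq_of_ne hb _)
    exact hab.ne (ha.trans hb.symm)

theorem eq_single_of_mem_indSet {x : V → ℝ} (hx : x ∈ indSet G U) {v : V} (hv : x v = 1) :
    x = Pi.single v 1 := by
  ext w
  by_cases h : w = v
  · subst h; simp [hv]
  · have := add_le_one_of_mem_indSet hx h
    rw [Pi.single_eq_of_ne h]
    exact le_antisymm (by linarith) (hx.1 w)

/-- A vertex of `U` without neighbours in `U` is a cone point of `Ind(G[U])`. -/
theorem contractibleSpace_indSet_of_cone {v : V} (hv : v ∈ U) (h : ∀ w ∈ U, ¬ G.Adj v w) :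
    ContractibleSpace (indSet G U) := by
  rw [contractible_iff_id_nullhomotopic]
  have key : ∀ p : I × indSet G U,
      (1 - (p.1 : ℝ)) • p.2.1 + (p.1 : ℝ) • Pi.single v 1 ∈ indSet G U := fun p =>
    mix_mem_indSet p.2.2 (single_mem_indSet hv)
      (single_adj fun w hw => p.2.2.2.1 w fun hw' => h w hw' hw) p.1.2
  exact ⟨⟨_, single_mem_indSet hv⟩, ⟨⟨⟨fun p => ⟨_, key p⟩,
    Continuous.subtype_mk (by fun_prop) _⟩, fun x => by ext; simp, fun x => by ext; simp⟩⟩⟩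

/-- Splitting off the weight of one vertex. -/
theorem exists_eq_mix_single {z : V → ℝ} (hz : z ∈ indSet G U) {v : V} (hv : z v ≠ 1) :
    ∃ a ∈ indSet G (U \ {v}), z = (1 - z v) • a + z v • Pi.single v 1 ∧
      ∀ w, z w = 0 → a w = 0 := by
  have hc : 0 < 1 - z v := sub_pos.2 (lt_of_le_of_ne (le_one_of_mem_indSet hz v) hv)
  have h0 : ∀ w, z w = 0 → ((1 - z v)⁻¹ • (z - z v • Pi.single v 1) : V → ℝ) w = 0 := by
    intro w hw
    by_cases h : w = v
    · subst h; simp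
    · simp [h, hw]
  refine ⟨(1 - z v)⁻¹ • (z - z v • Pi.single v 1), ⟨fun w => ?_, fun w hw => ?_,
    fun a b hab => ?_, ?_⟩, ?_, h0⟩
  · by_cases h : w = v
    · subst h; simp
    · simpa [h] using mul_nonneg (inv_nonneg.2 hc.le) (hz.1 w)
  · by_cases h : w = v
    · subst h; simp
    · exact h0 w (hz.2.1 w fun h' => hw ⟨h', h⟩)
  · exact (hz.2.2.1 a b hab).imp (h0 a) (h0 b)
  · simp only [Pi.smul_apply, Pi.sub_apply, smul_eq_mul, ← Finset.mul_sum,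
      Finset.sum_sub_distrib, hz.2.2.2]
    simpa using inv_mul_cancel₀ hc.ne'
  · rw [smul_smul, mul_inv_cancel₀ hc.ne', one_smul, sub_add_cancel]

/-- If the deletion and the link of a vertex are contractible, so is the complex. -/
theorem contractibleSpace_indSet_of_vertex {v : V} (hv : v ∈ U)
    [hd : ContractibleSpace (indSet G (U \ {v}))]
    [hl : ContractibleSpace (indSet G (U \ closedNbhd G v))] :
    ContractibleSpace (indSet G U) := by
  have hsub : U \ closedNbhd G v ⊆ U \ {v} :=
    Set.sdiff_subset_sdiff_right (by simp [closedNbhd])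
  obtain ⟨⟨a₀, ha₀⟩⟩ : Nonempty (indSet G (U \ closedNbhd G v)) := inferInstance
  -- The complex is its deletion of `v` with a cone over the link of `v` attached; the weight at `v`
  -- is the height in this cone.
  refine (isCone_linear (b := Pi.single v 1) (fun x => x v) (isCompact_indSet _ _)
    (isCompact_indSet G (U \ {v})) ⟨a₀, ha₀⟩ (indSet_mono hsub) (indSet_mono Set.sdiff_subset)
    ?_ ?_ ?_ ?_).contractibleSpace
  · intro a ha s hs
    refine mix_mem_indSet (indSet_mono Set.sdiff_subset ha) (single_mem_indSet hv)
      (single_adj fun w hw => ha.2.1 w fun h => h.2 (Or.inr hw)) hs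
  · intro l hl
    exact hl.2.1 v (by simp)
  · intro a ha s hs
    have : a v = 0 := ha.2.1 v (by simp [closedNbhd])
    simp [this]
  · intro z hz
    by_cases h0 : z v = 0
    · refine Or.inl ⟨hz.1, fun w hw => ?_, hz.2.2⟩
      by_cases h : w = v
      · rwa [h]
      · exact hz.2.1 w fun h' => hw ⟨h', h⟩
    · refine Or.inr ?_
      by_cases h1 : z v = 1
      · exact ⟨a₀, ha₀, 1, ⟨zero_le_one, le_rfl⟩, by simp [eq_single_of_mem_indSet hz h1]⟩
      · obtain ⟨a, ha, he, haz⟩ := exists_eq_mix_single hz h1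
        refine ⟨a, ⟨ha.1, fun w hw => ?_, ha.2.2⟩, z v, ⟨hz.1 v, le_one_of_mem_indSet hz v⟩,
          he.symm⟩
        by_cases h : w = v
        · exact ha.2.1 w (by simp [h])
        · by_cases hwU : w ∈ U
          · have hadj : G.Adj v w := by
              by_contra hadj
              refine hw ⟨hwU, ?_⟩
              rintro (h' | h')
              · exact h h'
              · exact hadj h'
            exact haz w ((hz.2.2.1 v w hadj).resolve_left h0)
          · exact haz w (hz.2.1 w hwU)

/-- `Ind(G)` is path-connected if the complement of `G` is connected. -/
theorem pathConnectedSpace_indSet [Nonempty V] (h : Gᶜ.Preconnected) :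
    PathConnectedSpace (indSet G Set.univ) := by
  rw [← isPathConnected_iff_pathConnectedSpace]
  have line : ∀ x y : V → ℝ, x ∈ indSet G Set.univ → y ∈ indSet G Set.univ →
      (∀ a b, G.Adj a b → x a = 0 ∨ y b = 0) → JoinedIn (indSet G Set.univ) x y := by
    intro x y hx hy hxy
    refine JoinedIn.ofLine (f := fun s => (1 - s) • x + s • y) (by fun_prop) (by simp) (by simp) ?_
    rintro _ ⟨s, hs, rfl⟩
    exact mix_mem_indSet hx hy hxy hs
  have hs : ∀ v : V, Pi.single v 1 ∈ indSet G Set.univ := fun v => single_mem_indSet trivial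
  have walk : ∀ v w : V, JoinedIn (indSet G Set.univ) (Pi.single v 1) (Pi.single w 1) := by
    intro v w
    obtain ⟨p⟩ := h v w
    induction p with
    | nil => exact JoinedIn.refl (hs _)
    | cons hab _ ih =>
      refine JoinedIn.trans (line _ _ (hs _) (hs _) (single_adj fun c hc => ?_)) ih
      refine Pi.single_eq_of_ne ?_ _
      rintro rfl
      exact (SimpleGraph.compl_adj _ _ _ |>.1 hab).2 hc.symm
  have vert : ∀ x ∈ indSet G Set.univ, ∃ v : V, JoinedIn (indSet G Set.univ) x (Pi.single v 1) := by
    intro x hx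
    obtain ⟨v, -, hv⟩ : ∃ v ∈ Finset.univ, x v ≠ 0 := by
      refine Finset.exists_ne_zero_of_sum_ne_zero ?_
      rw [hx.2.2.2]
      exact one_ne_zero
    exact ⟨v, line _ _ hx (hs v) (single_adj fun w hw => (hx.2.2.1 v w hw).resolve_left hv)⟩
  obtain ⟨v₀⟩ := ‹Nonempty V›
  refine ⟨_, hs v₀, fun {y} hy => ?_⟩
  obtain ⟨v, hv⟩ := vert y hy
  exact (walk v₀ v).trans hv.symm

/-! ### Removing an edge -/

/-- Removing the edge `uv` attaches a cone over `Ind(e ⊔ (G ∖ N[e]))` to `Ind(G)`. -/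
theorem exists_isCone_of_edge {G' : SimpleGraph V} {u v : V} (huv : u ≠ v) (hG' : ¬ G'.Adj u v)
    (hG : ∀ a b, G.Adj a b ↔ G'.Adj a b ∨ (a = u ∧ b = v) ∨ (a = v ∧ b = u)) :
    ∃ κ, IsCone (inclMap (indSet_mono (G := G) (Set.subset_univ (edgeAndFar G (u, v)))))
      (inclMap (indSet_anti (U := Set.univ) (show G' ≤ G from fun a b h => (hG a b).2 (.inl h))))
      κ := by
  have hle : G' ≤ G := fun a b h => (hG a b).2 (.inl h)
  have hadj : G.Adj u v := (hG u v).2 (by simp)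
  have hue : u ∈ edgeAndFar G (u, v) := by simp [edgeAndFar]
  have hve : v ∈ edgeAndFar G (u, v) := by simp [edgeAndFar]
  -- The apex is the midpoint of the segment `uv`, which is a face of `Ind(G')` but not of `Ind(G)`.
  let b : V → ℝ := (1 - (1 / 2 : ℝ)) • Pi.single u 1 + (1 / 2 : ℝ) • Pi.single v 1
  have hbu : b u = 1 / 2 := by simp [b, huv]; norm_num
  have hbv : b v = 1 / 2 := by simp [b, huv.symm]
  have hb0 : ∀ w, w ≠ u → w ≠ v → b w = 0 := fun w h1 h2 => by simp [b, h1, h2]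
  have hbmem : b ∈ indSet G' (edgeAndFar G (u, v)) := by
    refine mix_mem_indSet (single_mem_indSet hue) (single_mem_indSet hve) (single_adj fun w hw => ?_)
      (by norm_num)
    refine Pi.single_eq_of_ne ?_ _
    rintro rfl
    exact hG' hw.symm
  -- The height `2 min (x u) (x v)` vanishes exactly when `u` and `v` do not both carry weight, and
  -- equals `1` at the midpoint `b`.
  refine ⟨_, isCone_linear (b := b) (fun x => 2 * min (x u) (x v)) (isCompact_indSet _ _)
    (isCompact_indSet _ _) ⟨_, single_mem_indSet hue⟩ _ _ ?_ ?_ ?_ ?_⟩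
  · intro a ha s hs
    refine indSet_mono (Set.subset_univ _) (mix_mem_indSet (indSet_anti hle ha) hbmem ?_ hs)
    intro c d hcd
    by_contra! h
    have hc : c ∈ edgeAndFar G (u, v) := by_contra fun hc => h.1 (ha.2.1 c hc)
    have hd : d = u ∨ d = v := by
      by_contra! hd
      exact h.2 (hb0 d hd.1 hd.2)
    rcases hc with (rfl | rfl) | hc
    · rcases hd with rfl | rfl
      · exact hcd.ne rfl
      · exact hG' hcd
    · rcases hd with rfl | rfl
      · exact hG' hcd.symm
      · exact hcd.ne rfl
    · refine hc ?_
      rcases hd with rfl | rfl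
      · exact Or.inl (Or.inr (hle hcd.symm))
      · exact Or.inr (Or.inr (hle hcd.symm))
  · intro l hl
    have h1 := hl.1 u
    have h2 := hl.1 v
    rcases hl.2.2.1 u v hadj with h | h
    · simp [h, h2]
    · simp [h, h1]
  · intro a ha s hs
    have h1 := mul_nonneg (sub_nonneg.2 hs.2) (ha.1 u)
    have h2 := mul_nonneg (sub_nonneg.2 hs.2) (ha.1 v)
    simp only [Pi.add_apply, Pi.smul_apply, smul_eq_mul, hbu, hbv, min_add_add_right]
    rcases ha.2.2.1 u v hadj with h | h
    · rw [h, mul_zero, min_eq_left h2]; ring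
    · rw [h, mul_zero, min_eq_right h1]; ring
  · intro z hz
    by_cases h0 : z u = 0 ∨ z v = 0
    · refine Or.inl ⟨hz.1, hz.2.1, fun a b hab => ?_, hz.2.2.2⟩
      rcases (hG a b).1 hab with h | ⟨rfl, rfl⟩ | ⟨rfl, rfl⟩
      · exact hz.2.2.1 a b h
      · exact h0
      · exact h0.symm
    push Not at h0
    obtain ⟨hzu, hzv⟩ := h0
    refine Or.inr ?_
    have hle1 := add_le_one_of_mem_indSet hz huv
    obtain ⟨s, hs⟩ : ∃ s, s = 2 * min (z u) (z v) := ⟨_, rfl⟩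
    have hsu : s ≤ 2 * z u := by rw [hs]; linarith [min_le_left (z u) (z v)]
    have hsv : s ≤ 2 * z v := by rw [hs]; linarith [min_le_right (z u) (z v)]
    have hs0 : 0 ≤ s := by rw [hs]; linarith [le_min (hz.1 u) (hz.1 v)]
    by_cases h1 : s = 1
    · refine ⟨_, single_mem_indSet hue, 1, ⟨zero_le_one, le_rfl⟩, ?_⟩
      have eu : z u = 1 / 2 := by linarith
      have ev : z v = 1 / 2 := by linarith
      rw [sub_self, zero_smul, zero_add, one_smul]
      ext w
      by_cases hwu : w = u
      · rw [hwu, hbu, eu]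
      by_cases hwv : w = v
      · rw [hwv, hbv, ev]
      have hsum : z u + (z v + z w) ≤ 1 := by
        rw [← hz.2.2.2, ← Finset.sum_pair (f := z) (Ne.symm hwv),
          ← Finset.sum_insert (a := u) (by simp [huv, Ne.symm hwu])]
        exact Finset.sum_le_sum_of_subset_of_nonneg (Finset.subset_univ _) fun w _ _ => hz.1 w
      rw [hb0 w hwu hwv]
      exact le_antisymm (hz.1 w) (by linarith)
    have hc : 0 < 1 - s := by
      have : s ≤ 1 := by linarith
      exact sub_pos.2 (lt_of_le_of_ne this h1)
    have hout : ∀ w, w ≠ u → w ≠ v → z w = 0 → ((1 - s)⁻¹ • (z - s • b)) w = 0 := by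
      intro w h1 h2 h3
      simp [hb0 w h1 h2, h3]
    -- With `s = 2 min (z u) (z v)`, subtracting `s • b` brings the smaller of the two weights to
    -- zero, so the projection from the apex lands in `Ind(G)`.
    have hmin : ((1 - s)⁻¹ • (z - s • b)) u = 0 ∨ ((1 - s)⁻¹ • (z - s • b)) v = 0 := by
      rcases min_choice (z u) (z v) with h | h
      · left
        simp only [Pi.smul_apply, Pi.sub_apply, smul_eq_mul, hbu, hs, h]
        ring
      · right
        simp only [Pi.smul_apply, Pi.sub_apply, smul_eq_mul, hbv, hs, h]
        ring
    refine ⟨(1 - s)⁻¹ • (z - s • b), ⟨fun w => ?_, fun w hw => ?_, fun c d hcd => ?_, ?_⟩, s,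
      ⟨hs0, by linarith⟩, ?_⟩
    · refine mul_nonneg (inv_nonneg.2 hc.le) ?_
      by_cases hwu : w = u
      · subst hwu; simp [hbu]; linarith
      by_cases hwv : w = v
      · subst hwv; simp [hbv]; linarith
      simpa [hb0 w hwu hwv] using hz.1 w
    · have hwu : w ≠ u := fun h => hw (h ▸ hue)
      have hwv : w ≠ v := fun h => hw (h ▸ hve)
      refine hout w hwu hwv ?_
      have hw' : w ∈ edgeNbhd G (u, v) := by
        by_contra h
        exact hw (Or.inr h)
      rcases hw' with (h | h) | (h | h)
      · exact absurd h hwu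
      · have : G'.Adj u w := by
          rcases (hG u w).1 h with h | ⟨-, h⟩ | ⟨h, -⟩
          · exact h
          · exact absurd h hwv
          · exact absurd h huv
        exact (hz.2.2.1 u w this).resolve_left hzu
      · exact absurd h hwv
      · have : G'.Adj v w := by
          rcases (hG v w).1 h with h | ⟨h, -⟩ | ⟨-, h⟩
          · exact h
          · exact absurd h huv.symm
          · exact absurd h hwu
        exact (hz.2.2.1 v w this).resolve_left hzv
    · have key : ∀ w, z w = 0 → ((1 - s)⁻¹ • (z - s • b)) w = 0 := fun w hw =>
        hout w (fun h => hzu (h ▸ hw)) (fun h => hzv (h ▸ hw)) hw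
      rcases (hG c d).1 hcd with h | ⟨rfl, rfl⟩ | ⟨rfl, rfl⟩
      · exact (hz.2.2.1 c d h).imp (key c) (key d)
      · exact hmin
      · exact hmin.symm
    · simp only [Pi.smul_apply, Pi.sub_apply, smul_eq_mul, ← Finset.mul_sum,
        Finset.sum_sub_distrib, hz.2.2.2, hbmem.2.2.2, mul_one]
      exact inv_mul_cancel₀ hc.ne'
    · rw [smul_smul, mul_inv_cancel₀ hc.ne', one_smul, sub_add_cancel]

/-- The realization of the disjoint union of an edge and a graph on `S` is a suspension. -/
theorem exists_susp_homeomorph {u v : V} {S : Set V} (huv : G.Adj u v)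
    (hu : ∀ w ∈ S, w ≠ u ∧ ¬ G.Adj u w) (hv : ∀ w ∈ S, w ≠ v ∧ ¬ G.Adj v w)
    {F : Type u} [TopologicalSpace F] (e : F ≃ₜ indSet G S) :
    Nonempty (Susp F ≃ₜ indSet G ({u, v} ∪ S)) := by
  have : CompactSpace F := e.symm.compactSpace
  have hne := huv.ne
  have hum : u ∈ ({u, v} ∪ S : Set V) := by simp
  have hvm : v ∈ ({u, v} ∪ S : Set V) := by simp
  have heu : ∀ x, (e x).1 u = 0 := fun x => (e x).2.2.1 u fun h => (hu u h).1 rfl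
  have hev : ∀ x, (e x).1 v = 0 := fun x => (e x).2.2.1 v fun h => (hv v h).1 rfl
  -- Each suspension line runs from `u` to the point `e x` for `t ≤ 1/2` and on to `v` for `t ≥
  -- 1/2`. The difference of the weights at `v` and `u` is then `2t - 1`, which recovers `t`.
  let c : F × I → V → ℝ := fun p => max (1 - 2 * (p.2 : ℝ)) 0 • Pi.single u 1 +
    max (2 * (p.2 : ℝ) - 1) 0 • Pi.single v 1 + (1 - |2 * (p.2 : ℝ) - 1|) • (e p.1).1
  have hc0 : ∀ x (t : I), (t : ℝ) ≤ 1 / 2 → c (x, t) =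
      (1 - (1 - 2 * (t : ℝ))) • (e x).1 + (1 - 2 * (t : ℝ)) • Pi.single u 1 := by
    intro x t ht
    simp only [c]
    rw [max_eq_left (by linarith), max_eq_right (by linarith), abs_of_nonpos (by linarith)]
    module
  have hc1 : ∀ x (t : I), 1 / 2 ≤ (t : ℝ) → c (x, t) =
      (1 - (2 * (t : ℝ) - 1)) • (e x).1 + (2 * (t : ℝ) - 1) • Pi.single v 1 := by
    intro x t ht
    simp only [c]
    rw [max_eq_right (by linarith), max_eq_left (by linarith), abs_of_nonneg (by linarith)]
    module
  have hcm : ∀ p, c p ∈ indSet G ({u, v} ∪ S) := by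
    rintro ⟨x, t⟩
    have hx : (e x).1 ∈ indSet G ({u, v} ∪ S) := indSet_mono Set.subset_union_right (e x).2
    have ht0 := t.2.1
    have ht1 := t.2.2
    rcases le_total (t : ℝ) (1 / 2) with h | h
    · rw [hc0 x t h]
      exact mix_mem_indSet hx (single_mem_indSet hum) (single_adj fun w hw =>
        (e x).2.2.1 w fun h => (hu w h).2 hw) ⟨by linarith, by linarith⟩
    · rw [hc1 x t h]
      exact mix_mem_indSet hx (single_mem_indSet hvm) (single_adj fun w hw =>
        (e x).2.2.1 w fun h => (hv w h).2 hw) ⟨by linarith, by linarith⟩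
  have hcont : Continuous c := by fun_prop
  obtain ⟨k, hk0, hk1, hk⟩ := Susp.exists_desc
    (⟨fun p => ⟨c p, hcm p⟩, hcont.subtype_mk _⟩ : C(F × I, indSet G ({u, v} ∪ S)))
    ⟨_, single_mem_indSet hum⟩ ⟨_, single_mem_indSet hvm⟩
    (fun x => Subtype.ext (by simp [c])) (fun x => Subtype.ext (by simp [c]; norm_num))
  -- the height in the suspension
  have hd0 : (k (Susp.pole F)).1 v - (k (Susp.pole F)).1 u = -1 := by simp [hk0, hne.symm]
  have hd1 : (k (Susp.pole' F)).1 v - (k (Susp.pole' F)).1 u = 1 := by simp [hk1, hne]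
  have hd : ∀ x t, (k (Susp.mk F (x, t))).1 v - (k (Susp.mk F (x, t))).1 u = 2 * t - 1 := by
    intro x t
    rw [hk]
    simp only [ContinuousMap.coe_mk]
    rcases le_total (t : ℝ) (1 / 2) with h | h
    · rw [hc0 x t h]; simp [heu, hev, hne.symm]
    · rw [hc1 x t h]; simp [heu, hev, hne]
  have hind : ∀ z : Susp F, z = Susp.pole F ∨ z = Susp.pole' F ∨
      ∃ x, ∃ t : I, (0 : ℝ) < t ∧ (t : ℝ) < 1 ∧ z = Susp.mk F (x, t) := by
    refine Susp.ind (Or.inl rfl) (Or.inr (Or.inl rfl)) fun x t => ?_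
    by_cases h0 : t = 0
    · exact Or.inl (h0 ▸ Susp.mk_zero x)
    by_cases h1 : t = 1
    · exact Or.inr (Or.inl (h1 ▸ Susp.mk_one x))
    exact Or.inr (Or.inr ⟨x, t, unitInterval.pos_iff_ne_zero.2 h0,
      unitInterval.lt_one_iff_ne_one.2 h1, rfl⟩)
  have hinj : Function.Injective k := by
    intro z z' h
    have h' : (k z).1 v - (k z).1 u = (k z').1 v - (k z').1 u := by rw [h]
    rcases hind z with rfl | rfl | ⟨x, t, ht0, ht1, rfl⟩ <;>
      rcases hind z' with rfl | rfl | ⟨x', t', ht0', ht1', rfl⟩ <;>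
      simp only [hd0, hd1, hd] at h'
    · rfl
    · linarith
    · linarith
    · linarith
    · rfl
    · linarith
    · linarith
    · linarith
    · obtain rfl : t = t' := Subtype.ext (by linarith)
      have hpos : 0 < 1 - |2 * (t : ℝ) - 1| := by
        rw [sub_pos, abs_lt]
        constructor <;> linarith
      rw [hk, hk] at h
      have h2 : c (x, t) = c (x', t) := congrArg Subtype.val h
      have h3 : (e x).1 = (e x').1 := smul_right_injective _ hpos.ne' (add_left_cancel h2)
      rw [e.injective (Subtype.ext h3)]
  have hsurj : Function.Surjective k := by
    rintro ⟨z, hz⟩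
    -- Weight at one pole excludes weight at the other, so such a point lies on the segment from the
    -- pole `w` to a point over `S`.
    have aux : ∀ w : V, (w = u ∨ w = v) → z w ≠ 0 → z w ≠ 1 →
        ∃ x, z = (1 - z w) • (e x).1 + z w • Pi.single w 1 := by
      intro w hw h0 h1
      obtain ⟨a, ha, he, haz⟩ := exists_eq_mix_single hz h1
      have ha' : a ∈ indSet G S := by
        refine ⟨ha.1, fun y hy => ?_, ha.2.2⟩
        by_cases hyw : y = w
        · exact ha.2.1 y (by simp [hyw])
        by_cases hyz : z y = 0
        · exact haz y hyz
        exfalso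
        have hyU : y ∈ ({u, v} ∪ S : Set V) := by_contra fun h => hyz (hz.2.1 y h)
        have hnadj : ¬ G.Adj y w := fun hadj => (hz.2.2.1 y w hadj).elim hyz h0
        rcases hyU with (rfl | rfl) | h
        · rcases hw with rfl | rfl
          · exact hyw rfl
          · exact hnadj huv
        · rcases hw with rfl | rfl
          · exact hnadj huv.symm
          · exact hyw rfl
        · exact hy h
      exact ⟨e.symm ⟨a, ha'⟩, by simpa using he⟩
    by_cases hu1 : z u = 1
    · exact ⟨Susp.pole F, by rw [hk0]; exact Subtype.ext (eq_single_of_mem_indSet hz hu1).symm⟩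
    by_cases hv1 : z v = 1
    · exact ⟨Susp.pole' F, by rw [hk1]; exact Subtype.ext (eq_single_of_mem_indSet hz hv1).symm⟩
    have hu0 := hz.1 u
    have hv0 := hz.1 v
    have hu2 := le_one_of_mem_indSet hz u
    have hv2 := le_one_of_mem_indSet hz v
    by_cases h0 : z u = 0
    · by_cases h0' : z v = 0
      · have hzS : z ∈ indSet G S := by
          refine ⟨hz.1, fun y hy => ?_, hz.2.2⟩
          by_cases hyU : y ∈ ({u, v} ∪ S : Set V)
          · rcases hyU with (rfl | rfl) | h
            · exact h0
            · exact h0'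
            · exact absurd h hy
          · exact hz.2.1 y hyU
        refine ⟨Susp.mk F (e.symm ⟨z, hzS⟩, ⟨1 / 2, by norm_num, by norm_num⟩), ?_⟩
        rw [hk]
        refine Subtype.ext ?_
        simp only [ContinuousMap.coe_mk]
        rw [hc0 _ _ le_rfl]
        simp
      · obtain ⟨x, hx⟩ := aux v (Or.inr rfl) h0' hv1
        refine ⟨Susp.mk F (x, ⟨(1 + z v) / 2, by linarith, by linarith⟩), ?_⟩
        rw [hk]
        refine Subtype.ext ?_
        simp only [ContinuousMap.coe_mk]
        rw [hc1 _ _ (by simp only; linarith)]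
        have : 2 * ((1 + z v) / 2) - 1 = z v := by ring
        simp only [this]
        exact hx.symm
    · obtain ⟨x, hx⟩ := aux u (Or.inl rfl) h0 hu1
      refine ⟨Susp.mk F (x, ⟨(1 - z u) / 2, by linarith, by linarith⟩), ?_⟩
      rw [hk]
      refine Subtype.ext ?_
      simp only [ContinuousMap.coe_mk]
      rw [hc0 _ _ (by simp only; linarith)]
      have : 1 - 2 * ((1 - z u) / 2) = z u := by ring
      simp only [this]
      exact hx.symm
  exact ⟨Continuous.homeoOfEquivCompactToT2 (f := Equiv.ofBijective k ⟨hinj, hsurj⟩) k.continuous⟩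

/-- If `Ind(e ⊔ (G ∖ N[e])) → Ind(G)` is null-homotopic, then the removal of the edge `e` from `G`
splits off a double suspension. -/
theorem ptdEquiv_of_edge {G' : SimpleGraph V} {u v : V} (huv : u ≠ v) (hG' : ¬ G'.Adj u v)
    (hG : ∀ a b, G.Adj a b ↔ G'.Adj a b ∨ (a = u ∧ b = v) ∨ (a = v ∧ b = u))
    {U : Set V} (hU : edgeAndFar G (u, v) ⊆ U) [ContractibleSpace (indSet G U)]
    [PathConnectedSpace (indSet G Set.univ)] (p : indSet G Set.univ)
    (p' : indSet G' Set.univ) (hp : p'.1 = p.1) :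
    PtdEquiv p' (Wedge.inl p (fun _ : Unit => Susp.pole (Susp (Realization
      (Ind (G.induce (edgeNbhd G (u, v))ᶜ))))) p) := by
  obtain ⟨κ, hκ⟩ := exists_isCone_of_edge huv hG' hG
  have hadj : G.Adj u v := (hG u v).2 (by simp)
  obtain ⟨φ⟩ := exists_susp_homeomorph (S := (edgeNbhd G (u, v))ᶜ) hadj
    (fun w hw => ⟨fun h => hw (Or.inl (Or.inl h)), fun h => hw (Or.inl (Or.inr h))⟩)
    (fun w hw => ⟨fun h => hw (Or.inr (Or.inl h)), fun h => hw (Or.inr (Or.inr h))⟩)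
    (realizationHomeomorph G (edgeNbhd G (u, v))ᶜ)
  obtain ⟨c, ⟨F⟩⟩ := nullhomotopic_inclMap (indSet_mono (G := G) hU)
    (indSet_mono (Set.subset_univ U))
  -- The path moves the constant end of the null-homotopy to the prescribed base point.
  obtain ⟨γ⟩ := PathConnectedSpace.joined c p
  -- The suspension has its poles even when there are no far vertices, so the base of the cone is
  -- never empty.
  have : Nonempty (Susp (Realization (Ind (G.induce (edgeNbhd G (u, v))ᶜ)))) := ⟨Susp.pole _⟩
  obtain rfl : p' = inclMap (indSet_anti fun a b h => (hG a b).2 (.inl h)) p := Subtype.ext hp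
  refine (hκ.comp_homeomorph φ).ptdEquiv (isCone_wedge _ p) (ContinuousMap.Homotopic.trans
    ⟨F.comp (ContinuousMap.Homotopy.refl ⟨φ, φ.continuous⟩)⟩ ?_) p
  exact ⟨⟨⟨fun z => γ z.1, by fun_prop⟩, fun x => γ.source, fun x => by simp⟩⟩

end IndSet

end IndCplx

namespace IndCplx

/-! ### Adjacency in terms of representatives -/

section Adjacency

/-- `x, y ∈ {0, …, n - 1}` have distance at most `r` in the `n`-cycle. -/
def Near (n r x y : ℕ) : Prop :=
  (x ≤ y + r ∧ y ≤ x + r) ∨ n + x ≤ y + r ∨ n + y ≤ x + r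

variable {n r : ℕ}

theorem edist_circulantGraph_add_le (a : ZMod n) (k : ℕ) :
    (SimpleGraph.circulantGraph {(1 : ZMod n)}).edist a (a + k) ≤ k := by
  induction k with
  | zero => simp
  | succ k ih =>
    refine (SimpleGraph.edist_triangle (v := a + k)).trans ?_
    rw [Nat.cast_succ, Nat.cast_succ]
    refine add_le_add ih ?_
    rw [SimpleGraph.edist_le_one_iff_adj_or_eq]
    by_cases h : a + (k : ZMod n) = a + (k + 1)
    · exact Or.inr h
    · exact Or.inl (by simp [SimpleGraph.circulantGraph_adj, h])

variable [NeZero n]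

theorem near_one_of_eq_add_one {a b : ZMod n} (h : b = a + 1) : Near n 1 a.val b.val := by
  have ha := a.val_lt
  have hb : b.val = (a.val + 1) % n := by
    rw [h, ← ZMod.val_natCast, Nat.cast_succ, ZMod.natCast_val, ZMod.cast_id]
  unfold Near
  rcases Nat.lt_or_ge (a.val + 1) n with h' | h'
  · rw [Nat.mod_eq_of_lt h'] at hb
    omega
  · have h1 : a.val + 1 = n := by omega
    rw [h1, Nat.mod_self] at hb
    omega

/-- Replaces the graph distance by inequalities between representatives, which makes the later case
analyses linear arithmetic. One direction follows a shortest walk; the other bounds the distance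
along the shorter arc by `edist_circulantGraph_add_le`. -/
theorem cyclePower_adj {a b : ZMod n} :
    (cyclePower n r).Adj a b ↔ a.val ≠ b.val ∧ Near n r a.val b.val := by
  have hval : a ≠ b ↔ a.val ≠ b.val := (ZMod.val_injective n).ne_iff.symm
  rw [← hval]
  refine and_congr_right fun _ => ⟨fun h => ?_, fun h => ?_⟩
  · have hwalk : ∀ {a b : ZMod n} (p : (SimpleGraph.circulantGraph {(1 : ZMod n)}).Walk a b),
        Near n p.length a.val b.val := by
      intro a b p
      induction p with
      | nil => simp [Near]
      | @cons a c b hac p ih =>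
        have h1 : Near n 1 a.val c.val := by
          rw [SimpleGraph.circulantGraph_adj, Set.mem_singleton_iff, Set.mem_singleton_iff] at hac
          rcases hac.2 with h | h
          · have := near_one_of_eq_add_one (eq_add_of_sub_eq' h)
            unfold Near at this ⊢
            omega
          · exact near_one_of_eq_add_one (eq_add_of_sub_eq' h)
        have := a.val_lt
        have := b.val_lt
        have := c.val_lt
        rw [SimpleGraph.Walk.length_cons]
        unfold Near at *
        omega
    have htop : (SimpleGraph.circulantGraph {(1 : ZMod n)}).edist a b ≠ ⊤ :=
      ne_top_of_le_ne_top (ENat.natCast_ne_top r) h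
    obtain ⟨p, hp⟩ := SimpleGraph.exists_walk_of_edist_ne_top htop
    rw [← hp, Nat.cast_le] at h
    have := hwalk p
    unfold Near at *
    omega
  · have key : ∀ (a b : ZMod n) (k : ℕ), k ≤ r → (b.val = a.val + k ∨ b.val + n = a.val + k) →
        (SimpleGraph.circulantGraph {(1 : ZMod n)}).edist a b ≤ r := by
      intro a b k hk hab
      have hb : b = a + k := by
        rcases hab with hab | hab
        · have := congrArg (Nat.cast (R := ZMod n)) hab
          simpa using this
        · have := congrArg (Nat.cast (R := ZMod n)) hab
          simpa using this
      rw [hb]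
      exact (edist_circulantGraph_add_le a k).trans (by exact_mod_cast hk)
    rcases h with h | h | h
    · rcases le_total a.val b.val with h' | h'
      · exact key a b (b.val - a.val) (by omega) (by omega)
      · rw [SimpleGraph.edist_comm]
        exact key b a (a.val - b.val) (by omega) (by omega)
    · rw [SimpleGraph.edist_comm]
      have := b.val_lt
      exact key b a (n + a.val - b.val) (by omega) (by omega)
    · have := a.val_lt
      exact key a b (n + b.val - a.val) (by omega) (by omega)

theorem addEdges_adj {V : Type*} {G : SimpleGraph V} {S : Set (V × V)} {a b : V} :
    (addEdges G S).Adj a b ↔ G.Adj a b ∨ (a ≠ b ∧ ((a, b) ∈ S ∨ (b, a) ∈ S)) := by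
  simp only [addEdges, SimpleGraph.sup_adj, SimpleGraph.fromEdgeSet_adj, Set.mem_ofPred_eq,
    Sym2.eq_iff]
  refine or_congr_right (and_comm.trans (and_congr_right fun _ => ⟨?_, ?_⟩))
  · rintro ⟨e, he, ⟨rfl, rfl⟩ | ⟨rfl, rfl⟩⟩
    · exact Or.inl he
    · exact Or.inr he
  · rintro (h | h)
    · exact ⟨_, h, by simp⟩
    · exact ⟨_, h, by simp⟩

/-- Adjacency in a graph obtained from `C_n^r` by adding edges. -/
theorem addEdges_cyclePower_adj {S : Set (ZMod n × ZMod n)} {a b : ZMod n} :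
    (addEdges (cyclePower n r) S).Adj a b ↔
      a.val ≠ b.val ∧ (Near n r a.val b.val ∨ (a, b) ∈ S ∨ (b, a) ∈ S) := by
  rw [addEdges_adj, cyclePower_adj, ← (ZMod.val_injective n).ne_iff]
  tauto

end Adjacency

/-! ### The added edges -/

section Edges

variable {n r : ℕ}

/-- The edges of length `2r - s + 2` of stage `s`. -/
def shortEdges (n r s m : ℕ) : List (ZMod n × ZMod n) :=
  (List.range' 1 m).map
    (fun i : ℕ => ((i : ZMod n), (i : ZMod n) + 2 * (r : ZMod n) - (s : ZMod n) + 2))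

/-- The edges of length `3r - s + 3` of stage `s`. -/
def longEdges (n r s m : ℕ) : List (ZMod n × ZMod n) :=
  (List.range' 1 m).map
    (fun i : ℕ => ((i : ZMod n), (i : ZMod n) + 3 * (r : ZMod n) - (s : ZMod n) + 3))

theorem firstPhase_eq : firstPhase n r = (List.range' 1 (r - 1)).flatMap fun s =>
    shortEdges n r s (r + s + 1) ++ longEdges n r s s := by
  -- In `firstPhase` the lists of indices are cast elementwise to `ZMod n` by a monadic coercion;
  -- rewriting it as a map leaves natural indices.
  have h : ∀ l : List ℕ, (do let a ← l; pure (a : ZMod n)) = l.map (fun i : ℕ => (i : ZMod n)) :=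
    fun l => by simp [List.map_eq_flatMap]
  simp only [firstPhase, shortEdges, longEdges, h, List.map_map, Function.comp_def]

/-- Locates an entry of a flattened list: the block `f a` containing it, and the complete blocks
before that one. It identifies the stage of an edge of the first phase. -/
theorem flatMap_eq_append_cons {α β : Type*} {f : α → List β} {l : List α} {A B : List β} {e : β}
    (h : l.flatMap f = A ++ e :: B) : ∃ P a Q A' B', l = P ++ a :: Q ∧ f a = A' ++ e :: B' ∧
      A = P.flatMap f ++ A' := by
  induction l generalizing A with
  | nil => simp at h
  | cons a l ih =>
    rw [List.flatMap_cons, List.append_eq_append_iff] at h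
    rcases h with ⟨A₁, rfl, h⟩ | ⟨C, hC, h⟩
    · obtain ⟨P, b, Q, A', B', rfl, h1, rfl⟩ := ih h
      exact ⟨a :: P, b, Q, A', B', rfl, h1, by simp⟩
    · cases C with
      | nil =>
        obtain ⟨P, b, Q, A', B', rfl, h1, h2⟩ := ih (A := []) h.symm
        exact ⟨a :: P, b, Q, A', B', rfl, h1, by simp_all⟩
      | cons c C =>
        obtain ⟨rfl, -⟩ := List.cons.inj h
        exact ⟨[], a, l, A, C, rfl, hC, rfl⟩

theorem range'_eq_append_cons {m s : ℕ} {P Q : List ℕ} (h : List.range' 1 m = P ++ s :: Q) :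
    1 ≤ s ∧ s ≤ m ∧ P = List.range' 1 (s - 1) := by
  rw [List.range'_eq_append_iff] at h
  obtain ⟨k, hk, rfl, h⟩ := h
  rw [eq_comm, List.range'_eq_cons_iff] at h
  obtain ⟨rfl, h, -⟩ := h
  exact ⟨by omega, by omega, by congr 1; omega⟩

theorem map_range'_eq_append_cons {α : Type*} {f : ℕ → α} {m : ℕ} {A B : List α} {e : α}
    (h : (List.range' 1 m).map f = A ++ e :: B) :
    ∃ k, 1 ≤ k ∧ k ≤ m ∧ e = f k ∧ A = (List.range' 1 (k - 1)).map f := by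
  rw [List.map_eq_append_iff] at h
  obtain ⟨P, Q, h, rfl, hQ⟩ := h
  rw [List.map_eq_cons_iff] at hQ
  obtain ⟨k, Q, rfl, rfl, -⟩ := hQ
  obtain ⟨h1, h2, rfl⟩ := range'_eq_append_cons h
  exact ⟨k, h1, h2, rfl, rfl⟩

variable [NeZero n]

theorem eq_natCast_pair_iff {e : ZMod n × ZMod n} {i j : ℕ} (hi : i < n) (hj : j < n) :
    e = ((i : ZMod n), (j : ZMod n)) ↔ e.1.val = i ∧ e.2.val = j := by
  rw [Prod.ext_iff, ← (ZMod.val_injective n).eq_iff, ← (ZMod.val_injective n).eq_iff,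
    ZMod.val_natCast_of_lt hi, ZMod.val_natCast_of_lt hj]

/-- The ends are at most `3r + 3 < n`, so nothing wraps around and the equation holds between
representatives; `s` stands on the left to avoid truncated subtraction. -/
theorem mem_shortEdges {e : ZMod n × ZMod n} {s m : ℕ} (hs : s ≤ r) (hm : m ≤ r + s + 1)
    (hn : 5 * r + 4 ≤ n) : e ∈ shortEdges n r s m ↔
      1 ≤ e.1.val ∧ e.1.val ≤ m ∧ e.2.val + s = e.1.val + 2 * r + 2 := by
  have key : ∀ i, i ≤ m → (((i : ZMod n), (i : ZMod n) + 2 * (r : ZMod n) - (s : ZMod n) + 2) = e ↔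
      e.1.val = i ∧ e.2.val + s = i + 2 * r + 2) := by
    intro i hi
    have h : (i : ZMod n) + 2 * (r : ZMod n) - (s : ZMod n) + 2 =
        ((i + 2 * r + 2 - s : ℕ) : ZMod n) := by
      rw [Nat.cast_sub (by omega)]
      push_cast
      ring
    rw [h, eq_comm, eq_natCast_pair_iff (by omega) (by omega)]
    omega
  simp only [shortEdges, List.mem_map, List.mem_range'_1]
  constructor
  · rintro ⟨i, hi, h⟩
    have := (key i (by omega)).1 h
    omega
  · rintro ⟨h1, h2, h3⟩
    exact ⟨e.1.val, by omega, (key _ (by omega)).2 ⟨rfl, h3⟩⟩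

theorem mem_longEdges {e : ZMod n × ZMod n} {s m : ℕ} (hs : s ≤ r) (hm : m ≤ s)
    (hn : 5 * r + 4 ≤ n) : e ∈ longEdges n r s m ↔
      1 ≤ e.1.val ∧ e.1.val ≤ m ∧ e.2.val + s = e.1.val + 3 * r + 3 := by
  have key : ∀ i, i ≤ m → (((i : ZMod n), (i : ZMod n) + 3 * (r : ZMod n) - (s : ZMod n) + 3) = e ↔
      e.1.val = i ∧ e.2.val + s = i + 3 * r + 3) := by
    intro i hi
    have h : (i : ZMod n) + 3 * (r : ZMod n) - (s : ZMod n) + 3 =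
        ((i + 3 * r + 3 - s : ℕ) : ZMod n) := by
      rw [Nat.cast_sub (by omega)]
      push_cast
      ring
    rw [h, eq_comm, eq_natCast_pair_iff (by omega) (by omega)]
    omega
  simp only [longEdges, List.mem_map, List.mem_range'_1]
  constructor
  · rintro ⟨i, hi, h⟩
    have := (key i (by omega)).1 h
    omega
  · rintro ⟨h1, h2, h3⟩
    exact ⟨e.1.val, by omega, (key _ (by omega)).2 ⟨rfl, h3⟩⟩

/-- `x, y` are the ends of an edge of the first `s` stages of the first phase. -/
def FirstStages (r s x y : ℕ) : Prop :=
  1 ≤ x ∧ y ≤ 3 * r + 3 ∧ ((x + 2 * r + 2 ≤ y + s ∧ y ≤ x + 2 * r + 1) ∨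
    (x + 3 * r + 3 ≤ y + s ∧ y ≤ x + 3 * r + 2))

/-- `x, y` are the ends of an edge of the second phase. -/
def Second (n r x y : ℕ) : Prop :=
  3 * r + 4 ≤ y ∧ ((x = 0 ∧ y ≤ 4 * r + 3) ∨ n + y ≤ x + 4 * r + 3)

/-- Stage `t` adds all pairs inside `1, …, 3r + 3` of difference `2r - t + 2` or `3r - t + 3`, so
the stage can be read off from the difference of the ends. -/
theorem mem_firstStages {e : ZMod n × ZMod n} {s : ℕ} (hs : s + 1 ≤ r) (hn : 5 * r + 4 ≤ n) :
    (e ∈ (List.range' 1 s).flatMap fun s => shortEdges n r s (r + s + 1) ++ longEdges n r s s) ↔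
      FirstStages r s e.1.val e.2.val := by
  simp only [List.mem_flatMap, List.mem_append, List.mem_range'_1, FirstStages]
  constructor
  · rintro ⟨t, ht, h⟩
    rw [mem_shortEdges (by omega) (by omega) hn, mem_longEdges (by omega) (by omega) hn] at h
    omega
  · rintro ⟨h1, h2, h | h⟩
    · refine ⟨e.1.val + 2 * r + 2 - e.2.val, by omega, ?_⟩
      rw [mem_shortEdges (by omega) (by omega) hn]
      omega
    · refine ⟨e.1.val + 3 * r + 3 - e.2.val, by omega, ?_⟩
      rw [mem_longEdges (r := r) (by omega) (by omega) hn]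
      omega

theorem mem_firstPhase {e : ZMod n × ZMod n} (hr : 1 ≤ r) (hn : 5 * r + 4 ≤ n) :
    e ∈ firstPhase n r ↔ FirstStages r (r - 1) e.1.val e.2.val := by
  rw [firstPhase_eq, mem_firstStages (by omega) hn]

/-- The bounds `x < r` and `y ≤ r` follow from `1 ≤ y` and `x + y ≤ r`. The case `x = 0` is separate
because the representative of `-x` is then `0` instead of `n - x`. -/
theorem mem_secondPhase {e : ZMod n × ZMod n} (hn : 5 * r + 4 ≤ n) :
    e ∈ secondPhase n r ↔ Second n r e.1.val e.2.val := by
  have key : ∀ x y : ℕ, x < r → y ≤ r →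
      (e = (-(x : ZMod n), 3 * (r : ZMod n) + 3 + (y : ZMod n)) ↔
      (e.1.val + x = n ∨ e.1.val = 0 ∧ x = 0) ∧ e.2.val = 3 * r + 3 + y) := by
    intro x y hx hy
    have h2 : 3 * (r : ZMod n) + 3 + (y : ZMod n) = ((3 * r + 3 + y : ℕ) : ZMod n) := by
      push_cast
      ring
    have he := e.1.val_lt
    rcases Nat.eq_zero_or_pos x with rfl | h0
    · have h1 : -((0 : ℕ) : ZMod n) = ((0 : ℕ) : ZMod n) := by simp
      rw [h1, h2, eq_natCast_pair_iff (by omega) (by omega)]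
      omega
    · have h1 : -(x : ZMod n) = ((n - x : ℕ) : ZMod n) := by
        rw [Nat.cast_sub (by omega)]
        simp
      rw [h1, h2, eq_natCast_pair_iff (by omega) (by omega)]
      omega
  have he := e.1.val_lt
  simp only [secondPhase, Set.mem_ofPred_eq, Second]
  constructor
  · rintro ⟨x, y, hx, hy, hy', hxy, h⟩
    rw [key x y hx hy'] at h
    omega
  · rintro ⟨h1, h | h⟩
    · refine ⟨0, e.2.val - 3 * r - 3, by omega, by omega, by omega, by omega, ?_⟩
      rw [key _ _ (by omega) (by omega)]
      omega
    · refine ⟨n - e.1.val, e.2.val - 3 * r - 3, by omega, by omega, by omega, by omega, ?_⟩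
      rw [key _ _ (by omega) (by omega)]
      omega

/-- The edges that precede a given edge in the first phase. -/
theorem firstPhase_eq_append_cons {A B : List (ZMod n × ZMod n)} {e : ZMod n × ZMod n}
    (hn : 5 * r + 4 ≤ n) (h : firstPhase n r = A ++ e :: B) :
    ∃ s, 1 ≤ s ∧ s + 1 ≤ r ∧
      ((1 ≤ e.1.val ∧ e.1.val ≤ r + s + 1 ∧ e.2.val + s = e.1.val + 2 * r + 2 ∧
        ∀ f, f ∈ A ↔ FirstStages r (s - 1) f.1.val f.2.val ∨
          (1 ≤ f.1.val ∧ f.1.val < e.1.val ∧ f.2.val + s = f.1.val + 2 * r + 2)) ∨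
      (1 ≤ e.1.val ∧ e.1.val ≤ s ∧ e.2.val + s = e.1.val + 3 * r + 3 ∧
        ∀ f, f ∈ A ↔ FirstStages r (s - 1) f.1.val f.2.val ∨
          (1 ≤ f.1.val ∧ f.1.val ≤ r + s + 1 ∧ f.2.val + s = f.1.val + 2 * r + 2) ∨
          (1 ≤ f.1.val ∧ f.1.val < e.1.val ∧ f.2.val + s = f.1.val + 3 * r + 3))) := by
  rw [firstPhase_eq] at h
  obtain ⟨P, s, Q, A', B', hPQ, hs, rfl⟩ := flatMap_eq_append_cons h
  obtain ⟨hs1, hs2, rfl⟩ := range'_eq_append_cons hPQ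
  refine ⟨s, hs1, by omega, ?_⟩
  have hlong : ∀ {A' B'}, longEdges n r s s = A' ++ e :: B' → 1 ≤ e.1.val ∧ e.1.val ≤ s ∧
      e.2.val + s = e.1.val + 3 * r + 3 ∧ A' = longEdges n r s (e.1.val - 1) := by
    intro A' B' h
    have hm : e ∈ longEdges n r s s := by simp [h]
    obtain ⟨k, hk1, hk2, he, hA⟩ := map_range'_eq_append_cons h
    have hk : e.1.val = k := by rw [he]; exact ZMod.val_natCast_of_lt (by omega)
    obtain ⟨h1, h2, h3⟩ := (mem_longEdges (r := r) (by omega) le_rfl hn).1 hm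
    exact ⟨h1, h2, h3, hk ▸ hA⟩
  have hshort : ∀ {A' B'}, shortEdges n r s (r + s + 1) = A' ++ e :: B' → 1 ≤ e.1.val ∧
      e.1.val ≤ r + s + 1 ∧ e.2.val + s = e.1.val + 2 * r + 2 ∧
        A' = shortEdges n r s (e.1.val - 1) := by
    intro A' B' h
    have hm : e ∈ shortEdges n r s (r + s + 1) := by simp [h]
    obtain ⟨k, hk1, hk2, he, hA⟩ := map_range'_eq_append_cons h
    have hk : e.1.val = k := by rw [he]; exact ZMod.val_natCast_of_lt (by omega)
    obtain ⟨h1, h2, h3⟩ := (mem_shortEdges (r := r) (by omega) le_rfl hn).1 hm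
    exact ⟨h1, h2, h3, hk ▸ hA⟩
  have hlong' : ∀ {A' B'}, longEdges n r s s = A' ++ e :: B' →
      (1 ≤ e.1.val ∧ e.1.val ≤ s ∧ e.2.val + s = e.1.val + 3 * r + 3 ∧
        ∀ f, f ∈ ((List.range' 1 (s - 1)).flatMap fun s =>
            shortEdges n r s (r + s + 1) ++ longEdges n r s s) ++
              (shortEdges n r s (r + s + 1) ++ A') ↔
          FirstStages r (s - 1) f.1.val f.2.val ∨
          (1 ≤ f.1.val ∧ f.1.val ≤ r + s + 1 ∧ f.2.val + s = f.1.val + 2 * r + 2) ∨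
          (1 ≤ f.1.val ∧ f.1.val < e.1.val ∧ f.2.val + s = f.1.val + 3 * r + 3)) := by
    intro A' B' h
    obtain ⟨h1, h2, h3, rfl⟩ := hlong h
    refine ⟨h1, h2, h3, fun f => ?_⟩
    rw [List.mem_append, List.mem_append, mem_firstStages (by omega) hn,
      mem_shortEdges (by omega) le_rfl hn, mem_longEdges (r := r) (by omega) (by omega) hn]
    refine or_congr_right (or_congr_right ?_)
    omega
  rw [List.append_eq_append_iff] at hs
  rcases hs with ⟨A₁, rfl, h'⟩ | ⟨C, hC, h'⟩
  · exact Or.inr (hlong' h')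
  · cases C with
    | nil =>
      rw [List.append_nil] at hC
      have := hlong' (A' := []) h'.symm
      rw [hC, List.append_nil] at this
      exact Or.inr this
    | cons c C =>
      obtain ⟨rfl, -⟩ := List.cons.inj h'
      obtain ⟨h1, h2, h3, rfl⟩ := hshort hC
      refine Or.inl ⟨h1, h2, h3, fun f => ?_⟩
      rw [List.mem_append, mem_firstStages (by omega) hn, mem_shortEdges (by omega) (by omega) hn]
      refine or_congr_right ?_
      omega

end Edges

end IndCplx

namespace IndCplx

/-! ### The two contractibility criteria -/

section Criteria

universe u

variable {V : Type u} {G : SimpleGraph V}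

theorem nonempty_iso_pathGraph_four {x u v y : V} (hxu : G.Adj x u) (huv : G.Adj u v)
    (hvy : G.Adj v y) (hxv : ¬ G.Adj x v) (hxy : ¬ G.Adj x y) (huy : ¬ G.Adj u y)
    (hxv' : x ≠ v) (hxy' : x ≠ y) (huy' : u ≠ y) :
    Nonempty (G.induce {x, y, u, v} ≃g SimpleGraph.pathGraph 4) := by
  let f : Fin 4 → ({x, y, u, v} : Set V) :=
    ![⟨x, by simp⟩, ⟨u, by simp⟩, ⟨v, by simp⟩, ⟨y, by simp⟩]
  have hxu' := hxu.ne
  have huv' := huv.ne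
  have hvy' := hvy.ne
  have hf : Function.Bijective f := by
    constructor
    · intro i j h
      have h' := congrArg Subtype.val h
      fin_cases i <;> fin_cases j <;> simp_all [f]
    · rintro ⟨w, rfl | rfl | rfl | rfl⟩
      · exact ⟨0, rfl⟩
      · exact ⟨3, rfl⟩
      · exact ⟨1, rfl⟩
      · exact ⟨2, rfl⟩
  refine ⟨SimpleGraph.Iso.symm ⟨Equiv.ofBijective f hf, fun {i j} => ?_⟩⟩
  fin_cases i <;> fin_cases j <;>
    simp [f, SimpleGraph.pathGraph_adj, hxu, huv, hvy, hxv, hxy, huy, hxu.symm, huv.symm,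
      hvy.symm, G.adj_comm v x, G.adj_comm y x, G.adj_comm y u]

variable [Fintype V] [DecidableEq V]

/-- The disjoint union of a path on four vertices and any graph has contractible independence
complex. -/
theorem contractibleSpace_of_path {x u v y : V} {F : Set V} (huv : G.Adj u v)
    (hvy : G.Adj v y) (hxv : ¬ G.Adj x v) (hxy : ¬ G.Adj x y) (huy : ¬ G.Adj u y)
    (hxv' : x ≠ v) (huy' : u ≠ y) (hF : ∀ w ∈ F, ¬ G.Adj x w ∧ ¬ G.Adj y w ∧ w ≠ v) :
    ContractibleSpace (indSet G ({x, y, u, v} ∪ F)) := by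
  -- Without `v` the vertex `y` is isolated; in the link of `v`, where `u` and `y` are gone, `x` is
  -- isolated. Both complexes are cones.
  have h1 : ContractibleSpace (indSet G (({x, y, u, v} ∪ F) \ {v})) := by
    refine contractibleSpace_indSet_of_cone (v := y) ⟨by simp, hvy.ne'⟩ ?_
    rintro w ⟨(rfl | rfl | rfl | rfl) | hw, hw'⟩
    · exact fun h => hxy h.symm
    · exact G.irrefl
    · exact fun h => huy h.symm
    · exact absurd rfl hw'
    · exact (hF w hw).2.1
  have h2 : ContractibleSpace (indSet G (({x, y, u, v} ∪ F) \ closedNbhd G v)) := by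
    refine contractibleSpace_indSet_of_cone (v := x) ⟨by simp, ?_⟩ ?_
    · rintro (h | h)
      · exact hxv' h
      · exact hxv h.symm
    · rintro w ⟨(rfl | rfl | rfl | rfl) | hw, hw'⟩
      · exact G.irrefl
      · exact absurd (Or.inr hvy) hw'
      · exact absurd (Or.inr huv.symm) hw'
      · exact absurd (Or.inl rfl) hw'
      · exact (hF w hw).1
  exact contractibleSpace_indSet_of_vertex (v := v) (by simp)

/-- Vertices of `T`, in the order of decreasing `f`, can be removed one after another if each of
them has a predecessor that is not adjacent to any earlier non-neighbour. -/
theorem contractibleSpace_of_dismantling {R T : Set V} {t₀ : V} (ht₀ : t₀ ∈ T) (f : V → ℕ)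
    (hTR : Disjoint T R) (hR : ∀ t ∈ T, ∀ w ∈ R, ¬ G.Adj t w) (h0 : ∀ t ∈ T, t ≠ t₀ → f t₀ < f t)
    (h : ∀ t ∈ T, t ≠ t₀ → ∃ p ∈ T, f p < f t ∧ ¬ G.Adj t p ∧
      ∀ c ∈ T, c ≠ t → f c ≤ f t → ¬ G.Adj t c → ¬ G.Adj p c) :
    ContractibleSpace (indSet G (T ∪ R)) := by
  classical
  have key : ∀ S : Finset V, t₀ ∈ S → (∀ t ∈ S, t ∈ T) →
      (∀ t ∈ S, t ≠ t₀ → ∃ p ∈ S, f p < f t ∧ ¬ G.Adj t p ∧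
        ∀ c ∈ S, c ≠ t → f c ≤ f t → ¬ G.Adj t c → ¬ G.Adj p c) →
      ContractibleSpace (indSet G (S ∪ R : Set V)) := by
    intro S
    induction S using Finset.induction_on_max_value f with
    | empty => simp
    | insert a S haS hmax ih =>
      intro ht₀ hST hS
      -- As `t₀` is the strict minimum of `f`, it is removed last: here only `t₀` and `R` remain.
      by_cases ha : a = t₀
      · subst ha
        refine contractibleSpace_indSet_of_cone (v := a) (by simp) ?_
        rintro w (hw | hw)
        · rw [Finset.mem_coe, Finset.mem_insert] at hw
          rcases hw with rfl | hw
          · exact G.irrefl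
          · have := h0 w (hST w (by simp [hw])) (fun h => haS (h ▸ hw))
            exact absurd (hmax w hw) (by omega)
        · exact hR a (hST a (by simp)) w hw
      have ht₀S : t₀ ∈ S := (Finset.mem_insert.1 ht₀).resolve_left (Ne.symm ha)
      have haR : a ∉ R := Set.disjoint_left.1 hTR (hST a (by simp))
      obtain ⟨p, hp, hpa, hpadj, hpc⟩ := hS a (by simp) ha
      have hpS : p ∈ S := (Finset.mem_insert.1 hp).resolve_left (by rintro rfl; omega)
      have h1 : ContractibleSpace (indSet G (((insert a S : Finset V) ∪ R : Set V) \ {a})) := by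
        have : (((insert a S : Finset V) ∪ R : Set V) \ {a}) = (S ∪ R : Set V) := by
          ext w
          simp only [Finset.coe_insert, Set.mem_sdiff, Set.mem_union, Set.mem_insert_iff,
            Finset.mem_coe, Set.mem_singleton_iff]
          constructor
          · tauto
          · rintro (hw | hw)
            · exact ⟨Or.inl (Or.inr hw), fun h => haS (h ▸ hw)⟩
            · exact ⟨Or.inr hw, fun h => haR (h ▸ hw)⟩
        rw [this]
        refine ih ht₀S (fun t ht => hST t (by simp [ht])) fun t ht htt => ?_
        obtain ⟨q, hq, hqt, hqadj, hqc⟩ := hS t (by simp [ht]) htt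
        have hta := hmax t ht
        exact ⟨q, (Finset.mem_insert.1 hq).resolve_left (by rintro rfl; omega), hqt, hqadj,
          fun c hc => hqc c (by simp [hc])⟩
      -- The link of `a` consists of `R` and of those vertices of `S` that are not adjacent to `a`;
      -- none of them is adjacent to `p`, so it is a cone with apex `p`.
      have h2 : ContractibleSpace (indSet G
          (((insert a S : Finset V) ∪ R : Set V) \ closedNbhd G a)) := by
        refine contractibleSpace_indSet_of_cone (v := p) ⟨by simp [hpS], ?_⟩ ?_
        · rintro (h | h)
          · subst h; omega
          · exact hpadj h
        · rintro w ⟨hw | hw, hw'⟩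
          · have hwa : w ≠ a := fun h => hw' (Or.inl h)
            have hwS : w ∈ S := (Finset.mem_insert.1 hw).resolve_left hwa
            exact hpc w hw hwa (hmax w hwS) fun h => hw' (Or.inr h)
          · exact hR p (hST p hp) w hw
      exact contractibleSpace_indSet_of_vertex (v := a) (by simp)
  have := key T.toFinset (by simpa) (by simp) (by simpa using h)
  rwa [Set.coe_toFinset] at this

end Criteria

end IndCplx

namespace IndCplx

theorem exists_zmod_val {n m : ℕ} (hm : m < n) : ∃ a : ZMod n, a.val = m :=
  ⟨m, ZMod.val_natCast_of_lt hm⟩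

/-! ### The path criterion along the first phase. -/

section Phases

variable {n r : ℕ} [NeZero n] {G : SimpleGraph (ZMod n)}

/-- The criterion used for the edges of the first phase. -/
def PathCriterion {V : Type*} (G : SimpleGraph V) (e : V × V) : Prop :=
  ∃ x y, closedNbhd G x ∪ closedNbhd G y ⊆ edgeNbhd G e ∧ G.Adj x e.1 ∧ G.Adj e.1 e.2 ∧
    G.Adj e.2 y ∧ ¬ G.Adj x e.2 ∧ ¬ G.Adj x y ∧ ¬ G.Adj e.1 y ∧ x ≠ e.2 ∧ x ≠ y ∧ e.1 ≠ y

/-- Since `Near` is reflexive, passing to closed neighbourhoods removes the condition that the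
vertices be distinct. -/
theorem mem_closedNbhd_iff {P : ℕ → ℕ → Prop}
    (hG : ∀ a b, G.Adj a b ↔ a.val ≠ b.val ∧ (Near n r a.val b.val ∨ P a.val b.val ∨ P b.val a.val))
    (a b : ZMod n) : b ∈ closedNbhd G a ↔
      Near n r a.val b.val ∨ P a.val b.val ∨ P b.val a.val := by
  have h : Near n r a.val a.val := by unfold Near; omega
  rw [closedNbhd, Set.mem_insert_iff, SimpleGraph.mem_neighborSet, hG,
    ← (ZMod.val_injective n).eq_iff]
  by_cases hab : b.val = a.val
  · simp [hab, h]
  · simp [hab, Ne.symm hab]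

/-- The edges of length `2r - s + 2` satisfy the criterion. -/
theorem pathCriterion_short (hn : 5 * r + 4 ≤ n) {s : ℕ} (hs : 1 ≤ s) (hsr : s + 1 ≤ r)
    {e : ZMod n × ZMod n} (h1 : 1 ≤ e.1.val) (h2 : e.1.val ≤ r + s + 1)
    (h3 : e.2.val + s = e.1.val + 2 * r + 2)
    (hG : ∀ a b, G.Adj a b ↔ a.val ≠ b.val ∧ (Near n r a.val b.val ∨
      (FirstStages r (s - 1) a.val b.val ∨
        1 ≤ a.val ∧ a.val ≤ e.1.val ∧ b.val + s = a.val + 2 * r + 2) ∨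
      (FirstStages r (s - 1) b.val a.val ∨
        1 ≤ b.val ∧ b.val ≤ e.1.val ∧ a.val + s = b.val + 2 * r + 2))) :
    PathCriterion G e := by
  -- With `x = u + 1` and `y = v - 1`, the pairs `xv`, `uy`, `xy` have differences `2r - s + 1`, `2r
  -- - s + 1`, `2r - s`. These are at least `r + 1` because `s ≤ r - 1`, and shorter than every
  -- added edge.
  obtain ⟨x, hx⟩ := exists_zmod_val (n := n) (m := e.1.val + 1) (by omega)
  obtain ⟨y, hy⟩ := exists_zmod_val (n := n) (m := e.2.val - 1) (by omega)
  have hN := mem_closedNbhd_iff (P := fun a b => FirstStages r (s - 1) a b ∨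
        1 ≤ a ∧ a ≤ e.1.val ∧ b + s = a + 2 * r + 2) hG
  refine ⟨x, y, fun w hw => ?_, ?_⟩
  · have hw' := w.val_lt
    rw [edgeNbhd, Set.mem_union, hN, hN]
    rw [Set.mem_union, hN, hN] at hw
    clear hG hN
    generalize w.val = m at *
    generalize e.1.val = u at *
    generalize e.2.val = v at *
    rw [hx, hy] at hw
    rcases hw with (hw | (hw | hw) | (hw | hw)) | (hw | (hw | hw) | (hw | hw))
    -- The ball of radius `r` about `u + 1` exceeds the one about `u` only at `u + r + 1`, whose
    -- distance to `v` is `r - s + 1 ≤ r`. The same happens at `v - r - 1` for the ball about `y`.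
    · by_cases h : m = u + r + 1
      · exact Or.inr (Or.inl (by unfold Near; omega))
      · exact Or.inl (Or.inl (by unfold Near at hw ⊢; omega))
    · rcases hw with ⟨hw, hw2, hw3 | hw3⟩
      · exact Or.inr (Or.inl (by unfold Near; omega))
      · exact Or.inl (Or.inr (Or.inl (Or.inl (by unfold FirstStages; omega))))
    · omega
    -- Here `mx` has the shortest length of the previous stage, and `mu` is an edge of the current
    -- stage. It is already present since `m < u`: this uses that `i` increases.
    · by_cases h : u + s = m + 2 * r + 2
      · exact Or.inl (Or.inr (Or.inr (Or.inr (by unfold FirstStages at hw; omega))))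
      · exact Or.inl (Or.inr (Or.inr (Or.inl (by unfold FirstStages at hw ⊢; omega))))
    · exact Or.inr (Or.inr (Or.inr (Or.inl (by unfold FirstStages; omega))))
    · by_cases h : m + r + 1 = v
      · exact Or.inl (Or.inl (by unfold Near; omega))
      · exact Or.inr (Or.inl (by unfold Near at hw ⊢; omega))
    · by_cases h : m + s = v + 2 * r + 2
      · exact Or.inl (Or.inr (Or.inl (Or.inl (by unfold FirstStages at hw ⊢; omega))))
      · exact Or.inr (Or.inr (Or.inl (Or.inl (by unfold FirstStages at hw ⊢; omega))))
    · omega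
    · rcases hw with ⟨hw, hw2, hw3 | hw3⟩
      · exact Or.inl (Or.inl (by unfold Near; omega))
      · exact Or.inr (Or.inr (Or.inr (Or.inl (by unfold FirstStages; omega))))
    · exact Or.inl (Or.inl (by unfold Near; omega))
  · simp only [hG, ← (ZMod.val_injective n).ne_iff]
    refine ⟨⟨by omega, Or.inl (by unfold Near; omega)⟩, ⟨by omega, Or.inr (Or.inl (Or.inr (by omega)))⟩,
      ⟨by omega, Or.inl (by unfold Near; omega)⟩, ?_, ?_, ?_, by omega, by omega, by omega⟩ <;>
    · rintro ⟨-, h | (h | h) | (h | h)⟩ <;> (try unfold Near at h) <;> (try unfold FirstStages at h) <;> omega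

set_option maxHeartbeats 1000000 in
/-- The edges of length `3r - s + 3` satisfy the criterion. -/
theorem pathCriterion_long (hn : 5 * r + 4 ≤ n) {s : ℕ} (hs : 1 ≤ s) (hsr : s + 1 ≤ r)
    {e : ZMod n × ZMod n} (h1 : 1 ≤ e.1.val) (h2 : e.1.val ≤ s)
    (h3 : e.2.val + s = e.1.val + 3 * r + 3)
    (hG : ∀ a b, G.Adj a b ↔ a.val ≠ b.val ∧ (Near n r a.val b.val ∨
      (FirstStages r (s - 1) a.val b.val ∨
        (1 ≤ a.val ∧ a.val ≤ r + s + 1 ∧ b.val + s = a.val + 2 * r + 2) ∨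
        1 ≤ a.val ∧ a.val ≤ e.1.val ∧ b.val + s = a.val + 3 * r + 3) ∨
      (FirstStages r (s - 1) b.val a.val ∨
        (1 ≤ b.val ∧ b.val ≤ r + s + 1 ∧ a.val + s = b.val + 2 * r + 2) ∨
        1 ≤ b.val ∧ b.val ≤ e.1.val ∧ a.val + s = b.val + 3 * r + 3))) :
    PathCriterion G e := by
  -- The differences of `xv`, `uy`, `xy` are now `3r - s + 2`, `3r - s + 2`, `3r - s + 1`: below the
  -- long edges added so far, and above the longest short edge, whose length is `2r + 1`.
  obtain ⟨x, hx⟩ := exists_zmod_val (n := n) (m := e.1.val + 1) (by omega)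
  obtain ⟨y, hy⟩ := exists_zmod_val (n := n) (m := e.2.val - 1) (by omega)
  have hN := mem_closedNbhd_iff (P := fun a b => FirstStages r (s - 1) a b ∨
        (1 ≤ a ∧ a ≤ r + s + 1 ∧ b + s = a + 2 * r + 2) ∨
        1 ≤ a ∧ a ≤ e.1.val ∧ b + s = a + 3 * r + 3) hG
  refine ⟨x, y, fun w hw => ?_, ?_⟩
  · have hw' := w.val_lt
    rw [edgeNbhd, Set.mem_union, hN, hN]
    rw [Set.mem_union, hN, hN] at hw
    clear hG hN
    generalize w.val = m at *
    generalize e.1.val = u at *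
    generalize e.2.val = v at *
    rw [hx, hy] at hw
    rcases hw with (hw | (hw | hw | hw) | (hw | hw | hw)) | (hw | (hw | hw | hw) | (hw | hw | hw))
    -- Here `v - m = 2r - s + 2`, the short length of the same stage; for this reason the short
    -- edges of a stage precede the long ones. The vertex `v - r - 1` is handled symmetrically
    -- through `u`.
    · by_cases h : m = u + r + 1
      · exact Or.inr (Or.inr (Or.inr (Or.inr (Or.inl (by omega)))))
      · exact Or.inl (Or.inl (by unfold Near at hw ⊢; omega))
    -- The difference `2r + 2` is never filled in, but then `v - m = r - s + 1 ≤ r`.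
    · by_cases h : m = u + 2 * r + 2
      · exact Or.inr (Or.inl (by unfold Near; omega))
      · exact Or.inl (Or.inr (Or.inl (Or.inl (by unfold FirstStages at hw ⊢; omega))))
    · by_cases h : m = u + 2 * r + 2
      · exact Or.inr (Or.inl (by unfold Near; omega))
      · exact Or.inl (Or.inr (Or.inl (Or.inl (by unfold FirstStages; omega))))
    · omega
    · by_cases h : u + s = m + 2 * r + 2
      · exact Or.inl (Or.inr (Or.inr (Or.inr (Or.inl (by omega)))))
      · exact Or.inl (Or.inr (Or.inr (Or.inl (by unfold FirstStages at hw ⊢; omega))))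
    · exact Or.inr (Or.inr (Or.inr (Or.inl (by unfold FirstStages; omega))))
    · omega
    · by_cases h : m + r + 1 = v
      · exact Or.inl (Or.inr (Or.inl (Or.inr (Or.inl (by omega)))))
      · exact Or.inr (Or.inl (by unfold Near at hw ⊢; omega))
    · unfold FirstStages at hw; omega
    · omega
    · omega
    · by_cases h : v = m + 2 * r + 2
      · exact Or.inl (Or.inl (by unfold Near; omega))
      · exact Or.inr (Or.inr (Or.inr (Or.inl (by unfold FirstStages at hw ⊢; omega))))
    · by_cases h : v = m + 2 * r + 2
      · exact Or.inl (Or.inl (by unfold Near; omega))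
      · exact Or.inr (Or.inr (Or.inr (Or.inl (by unfold FirstStages; omega))))
    · exact Or.inr (Or.inr (Or.inr (Or.inl (by unfold FirstStages; omega))))
  · simp only [hG, ← (ZMod.val_injective n).ne_iff]
    refine ⟨⟨by omega, Or.inl (by unfold Near; omega)⟩, ⟨by omega, Or.inr (Or.inl (Or.inr (Or.inr (by omega))))⟩,
      ⟨by omega, Or.inl (by unfold Near; omega)⟩, ?_, ?_, ?_, by omega, by omega, by omega⟩ <;>
    · rintro ⟨-, h | (h | h | h) | (h | h | h)⟩ <;> (try unfold Near at h) <;> (try unfold FirstStages at h) <;> omega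

end Phases

end IndCplx

namespace IndCplx

/-! ### The strip of triangles and the edges of the second phase. -/

section SecondPhase

variable {n r : ℕ} [NeZero n] {G : SimpleGraph (ZMod n)}

/-- Distances of independent vertices among `1, …, 3r + 3` after the first phase. -/
def Apart (r a b : ℕ) : Prop :=
  a = b ∨ a = b + r + 1 ∨ b = a + r + 1 ∨ a = b + r + 2 ∨ b = a + r + 2 ∨
    a = b + 2 * r + 2 ∨ b = a + 2 * r + 2 ∨ a = b + 2 * r + 3 ∨ b = a + 2 * r + 3

/-- The position of a vertex among `1, …, 3r + 3` in the strip of triangles that remains of the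
independence complex after the first phase, with the strip cut open at `y`. -/
def stripPos (r y m : ℕ) : ℕ :=
  let q := if m ≤ r + 1 then 3 * m + 2 else if m ≤ 2 * r + 2 then 3 * (m - r - 1) + 1 else
    3 * (m - 2 * r - 2)
  if 3 * y + 4 ≤ q then q else q + (3 * r + 3)

/-- The predecessor of a vertex in the strip. -/
theorem exists_stripPos_pred {y : ℕ} (hy : 1 ≤ y) (hyr : y ≤ r) {τ : ℕ → Prop}
    (hτ : ∀ m, τ m → 1 ≤ m ∧ m ≤ 3 * r + 3 ∧ m ≠ y ∧ m ≠ 2 * r + 3 + y)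
    (hM : ∀ m, r + 1 ≤ m → m ≤ 2 * r + 3 → τ m)
    (hLR : ∀ a, 1 ≤ a → a ≤ r → a ≠ y → τ a ∨ τ (2 * r + 3 + a)) {t : ℕ} (ht : τ t)
    (ht0 : t ≠ y + r + 2) :
    ∃ p, τ p ∧ stripPos r y p < stripPos r y t ∧ Apart r t p ∧
      ∀ c, τ c → c ≠ t → stripPos r y c ≤ stripPos r y t → Apart r t c → Apart r p c := by
  have ht' := hτ t ht
  -- Write `L_a = a`, `M_a = a + r + 1`, `R_a = a + 2r + 2` for `1 ≤ a ≤ r + 1`. In the order `…,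
  -- R_a, M_a, L_a, R_{a+1}, M_{a+1}, …` distinct vertices are `Apart` exactly when they are at most
  -- two places apart, except for the closing edge from `L_{r+1} = r + 1` to `R_1 = 2r + 3`.
  -- Removing `L_y` and `R_{y+1}` cuts the band. Elsewhere `hM` and `hLR` exclude two consecutive
  -- gaps, so one of the two preceding places is occupied; the predecessor is the nearest occupied
  -- one.
  rcases Nat.lt_or_ge (r + 1) t with h1 | h1
  · rcases Nat.lt_or_ge (2 * r + 2) t with h2 | h2
    · by_cases h3 : t = 2 * r + 3
      · refine ⟨r + 1, hM _ (by omega) (by omega), ?_, ?_, fun c hc hct hle hap => ?_⟩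
        · unfold stripPos; grind
        · unfold Apart; omega
        · have hc' := hτ c hc
          unfold stripPos Apart at *; grind
      · by_cases h4 : τ (t - 2 * r - 3)
        · refine ⟨t - 2 * r - 3, h4, ?_, ?_, fun c hc hct hle hap => ?_⟩
          · unfold stripPos; grind
          · unfold Apart; omega
          · have hc' := hτ c hc
            unfold stripPos Apart at *; grind
        · refine ⟨t - r - 2, hM _ (by omega) (by omega), ?_, ?_, fun c hc hct hle hap => ?_⟩
          · unfold stripPos; grind
          · unfold Apart; omega
          · have hc' := hτ c hc
            have hc'' : c ≠ t - 2 * r - 3 := fun h => h4 (h ▸ hc)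
            unfold stripPos Apart at *; grind
    · by_cases h3 : τ (t + r + 1)
      · refine ⟨t + r + 1, h3, ?_, ?_, fun c hc hct hle hap => ?_⟩
        · have hp := hτ _ h3
          unfold stripPos; grind
        · unfold Apart; omega
        · have hc' := hτ c hc
          unfold stripPos Apart at *; grind
      · have h4 : t ≠ r + 2 := fun h => h3 (hM _ (by omega) (by omega))
        have h5 : τ (t - r - 2) := by
          refine (hLR (t - r - 2) (by omega) (by omega) (by omega)).resolve_right fun h => h3 ?_
          rwa [show 2 * r + 3 + (t - r - 2) = t + r + 1 by omega] at h
        refine ⟨t - r - 2, h5, ?_, ?_, fun c hc hct hle hap => ?_⟩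
        · unfold stripPos; grind
        · unfold Apart; omega
        · have hc' := hτ c hc
          have hc'' : c ≠ t + r + 1 := fun h => h3 (h ▸ hc)
          unfold stripPos Apart at *; grind
  · refine ⟨t + r + 1, hM _ (by omega) (by omega), ?_, ?_, fun c hc hct hle hap => ?_⟩
    · unfold stripPos; grind
    · unfold Apart; omega
    · have hc' := hτ c hc
      unfold stripPos Apart at *; grind

/-- Parts of the strip have contractible independence complex. -/
theorem contractibleSpace_strip (hn : 3 * r + 3 < n) {y : ℕ} (hy : 1 ≤ y) (hyr : y ≤ r)
    {τ : ℕ → Prop} (hτ : ∀ m, τ m → 1 ≤ m ∧ m ≤ 3 * r + 3 ∧ m ≠ y ∧ m ≠ 2 * r + 3 + y)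
    (hM : ∀ m, r + 1 ≤ m → m ≤ 2 * r + 3 → τ m)
    (hLR : ∀ a, 1 ≤ a → a ≤ r → a ≠ y → τ a ∨ τ (2 * r + 3 + a))
    (hG : ∀ a b : ZMod n, 1 ≤ a.val → a.val ≤ 3 * r + 3 → 1 ≤ b.val → b.val ≤ 3 * r + 3 →
      (¬ G.Adj a b ↔ Apart r a.val b.val))
    {R : Set (ZMod n)} (hR : ∀ w ∈ R, ¬ (1 ≤ w.val ∧ w.val ≤ 3 * r + 3))
    (hRG : ∀ a : ZMod n, 1 ≤ a.val → a.val ≤ 3 * r + 3 → ∀ w ∈ R, ¬ G.Adj a w) :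
    ContractibleSpace (indSet G ({w | τ w.val} ∪ R)) := by
  have hτ' : ∀ {m}, τ m → 1 ≤ m ∧ m ≤ 3 * r + 3 := fun h => ⟨(hτ _ h).1, (hτ _ h).2.1⟩
  -- This is `M_{y+1}`, at position `3y + 4`, the first place after the cut.
  obtain ⟨t₀, ht₀⟩ := exists_zmod_val (n := n) (m := y + r + 2) (by omega)
  have hm : τ t₀.val := hM _ (by omega) (by omega)
  refine contractibleSpace_of_dismantling (t₀ := t₀) hm (fun w => stripPos r y w.val) ?_ ?_ ?_ ?_
  · exact Set.disjoint_left.2 fun w hw hwR => hR w hwR (hτ' hw)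
  · exact fun t ht w hw => hRG t (hτ' ht).1 (hτ' ht).2 w hw
  · intro t ht htt
    have h1 : t.val ≠ t₀.val := (ZMod.val_injective n).ne htt
    have h2 := hτ _ ht
    simp only [ht₀] at h1 ⊢
    unfold stripPos
    grind
  · intro t ht htt
    have h1 : t.val ≠ y + r + 2 := ht₀ ▸ (ZMod.val_injective n).ne htt
    obtain ⟨p, hp, hpt, hap, hc⟩ := exists_stripPos_pred hy hyr hτ hM hLR ht h1
    obtain ⟨q, rfl⟩ := exists_zmod_val (n := n) (m := p) (by have := hτ' hp; omega)
    refine ⟨q, hp, hpt, ?_, fun c hcm hct hle hadj => ?_⟩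
    · exact (hG t q (hτ' ht).1 (hτ' ht).2 (hτ' hp).1 (hτ' hp).2).2 hap
    · rw [hG t c (hτ' ht).1 (hτ' ht).2 (hτ' hcm).1 (hτ' hcm).2] at hadj
      exact (hG q c (hτ' hp).1 (hτ' hp).2 (hτ' hcm).1 (hτ' hcm).2).2
        (hc _ hcm ((ZMod.val_injective n).ne hct) hle hadj)

/-- Differences up to `r` belong to `C_n^r`, and the first phase fills `r + 3, …, 2r + 1` and `2r +
4, …, 3r + 2`. What remains is the list in `Apart`. As `n ≥ 5r + 4`, the block is too short for
adjacency around the far side of the cycle. -/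
theorem apart_iff {r n a b : ℕ} (hr : 1 ≤ r) (hn : 5 * r + 4 ≤ n) (ha : 1 ≤ a)
    (ha' : a ≤ 3 * r + 3) (hb : 1 ≤ b) (hb' : b ≤ 3 * r + 3) :
    ¬ (a ≠ b ∧ (Near n r a b ∨ FirstStages r (r - 1) a b ∨ FirstStages r (r - 1) b a)) ↔
      Apart r a b := by
  wlog hab : a ≤ b generalizing a b
  · have := this hb hb' ha ha' (le_of_not_ge hab)
    have e1 : Near n r a b ↔ Near n r b a := by unfold Near; tauto
    have e2 : Apart r a b ↔ Apart r b a := by unfold Apart; grind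
    rw [e1, e2, ← this, ne_comm, or_comm (a := FirstStages r (r - 1) a b)]
  constructor
  · intro h
    by_contra h'
    refine h ⟨fun h => h' (by unfold Apart; omega), ?_⟩
    by_cases h1 : b ≤ a + r
    · exact Or.inl (by unfold Near; omega)
    · refine Or.inr (Or.inl ?_)
      unfold Apart at h'
      unfold FirstStages
      omega
  · rintro h ⟨h1, h2 | h2 | h2⟩
    · unfold Apart at h; unfold Near at h2; omega
    · unfold Apart at h; unfold FirstStages at h2; omega
    · unfold FirstStages at h2; omega

/-- Every edge of the second phase is, together with the vertices far from it, contained in a set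
of vertices whose independence complex is contractible. -/
theorem exists_contractible_second (hr : 1 ≤ r) (hn : 5 * r + 4 ≤ n) {Q : ZMod n → ZMod n → Prop}
    (hQ : ∀ a b, Q a b → Second n r a.val b.val) {e : ZMod n × ZMod n} (he : Q e.1 e.2)
    (hG : ∀ a b, G.Adj a b ↔ a.val ≠ b.val ∧ (Near n r a.val b.val ∨
      (FirstStages r (r - 1) a.val b.val ∨ Q a b) ∨
      (FirstStages r (r - 1) b.val a.val ∨ Q b a))) :
    ∃ U, edgeAndFar G e ⊆ U ∧ ContractibleSpace (indSet G U) := by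
  obtain ⟨u, v⟩ := e
  simp only at he
  have hsec := hQ _ _ he
  have hu := u.val_lt
  have hv := v.val_lt
  obtain ⟨x, y, hx, hy, hy1, hxy⟩ : ∃ x y, (u.val = 0 ∧ x = 0 ∨ u.val + x = n) ∧
      v.val = 3 * r + 3 + y ∧ 1 ≤ y ∧ x + y ≤ r := by
    unfold Second at hsec
    rcases hsec with ⟨h1, h | h⟩
    · exact ⟨0, v.val - 3 * r - 3, by omega, by omega, by omega, by omega⟩
    · exact ⟨n - u.val, v.val - 3 * r - 3, by omega, by omega, by omega, by omega⟩
  have hQW : ∀ a b : ZMod n, 1 ≤ a.val → a.val ≤ 3 * r + 3 → ¬ Q a b ∧ ¬ Q b a := by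
    intro a b h1 h2
    have hb := b.val_lt
    constructor <;> intro h <;> have := hQ _ _ h <;> unfold Second at this <;> omega
  have huv : G.Adj u v := (hG u v).2 ⟨by omega, Or.inr (Or.inl (Or.inr he))⟩
  -- adjacency to the vertices `1, …, 3r + 3`
  have hWW : ∀ a b : ZMod n, 1 ≤ a.val → a.val ≤ 3 * r + 3 → 1 ≤ b.val → b.val ≤ 3 * r + 3 →
      (¬ G.Adj a b ↔ Apart r a.val b.val) := by
    intro a b ha1 ha2 hb1 hb2
    have h1 := hQW a b ha1 ha2
    simp only [hG, h1.1, h1.2, or_false]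
    exact apart_iff hr hn ha1 ha2 hb1 hb2
  have huW : ∀ a : ZMod n, 1 ≤ a.val → a.val ≤ 3 * r + 3 → (G.Adj u a ↔ a.val + x ≤ r) := by
    intro a ha1 ha2
    have h1 := hQW a u ha1 ha2
    simp only [hG, h1.1, h1.2, or_false]
    unfold Near FirstStages
    grind
  have hvW : ∀ a : ZMod n, 1 ≤ a.val → a.val ≤ 3 * r + 3 →
      (G.Adj v a ↔ 2 * r + 3 + y ≤ a.val) := by
    intro a ha1 ha2
    have h1 := hQW a v ha1 ha2
    simp only [hG, h1.1, h1.2, or_false]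
    unfold Near FirstStages
    grind
  -- the far vertices outside `1, …, 3r + 3`
  let R : Set (ZMod n) := (edgeNbhd G (u, v))ᶜ \ {w | 1 ≤ w.val ∧ w.val ≤ 3 * r + 3}
  have hR : ∀ w ∈ R, ¬ (1 ≤ w.val ∧ w.val ≤ 3 * r + 3) := fun w hw => hw.2
  have hRu : ∀ w ∈ R, w ∉ closedNbhd G u := fun w hw h => hw.1 (Or.inl h)
  have hRv : ∀ w ∈ R, w ∉ closedNbhd G v := fun w hw h => hw.1 (Or.inr h)
  -- A vertex outside the block with a neighbour in it lies in `-(r-1), …, 0` or in `3r + 4, …, 4r +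
  -- 3`. These intervals contain `u` and `v` respectively and have length below `r`, so the vertex
  -- is not far from `e`.
  have hRW : ∀ a : ZMod n, 1 ≤ a.val → a.val ≤ 3 * r + 3 → ∀ w ∈ R, ¬ G.Adj a w := by
    intro a ha1 ha2 w hw hadj
    have hw1 := hR w hw
    have hwl := w.val_lt
    have h1 := hQW a w ha1 ha2
    have h2 : ¬ Near n r u.val w.val := by
      intro h
      refine hRu w hw ?_
      by_cases h' : w = u
      · exact Or.inl h'
      · exact Or.inr ((hG u w).2 ⟨(ZMod.val_injective n).ne (Ne.symm h'), Or.inl h⟩)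
    have h3 : ¬ Near n r v.val w.val := by
      intro h
      refine hRv w hw ?_
      by_cases h' : w = v
      · exact Or.inl h'
      · exact Or.inr ((hG v w).2 ⟨(ZMod.val_injective n).ne (Ne.symm h'), Or.inl h⟩)
    simp only [hG, h1.1, h1.2, or_false] at hadj
    unfold Near FirstStages at *
    omega
  have strip : ∀ τ : ℕ → Prop, (∀ m, τ m → 1 ≤ m ∧ m ≤ 3 * r + 3 ∧ m ≠ y ∧ m ≠ 2 * r + 3 + y) →
      (∀ m, r + 1 ≤ m → m ≤ 2 * r + 3 → τ m) →
      (∀ a, 1 ≤ a → a ≤ r → a ≠ y → τ a ∨ τ (2 * r + 3 + a)) →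
      ContractibleSpace (indSet G ({w | τ w.val} ∪ R)) := fun τ h1 h2 h3 =>
    contractibleSpace_strip (by omega) hy1 (by omega) h1 h2 h3 hWW hR hRW
  -- The removed vertex `y` is adjacent to `u`, as `x + y ≤ r`, and `2r + 3 + y = v - r` is adjacent
  -- to `v`. Hence `W` still contains all far vertices.
  let τ : ℕ → Prop := fun m => 1 ≤ m ∧ m ≤ 3 * r + 3 ∧ m ≠ y ∧ m ≠ 2 * r + 3 + y
  let W : Set (ZMod n) := {w | τ w.val} ∪ R
  have hW : ContractibleSpace (indSet G W) :=
    strip τ (fun m h => h) (fun m _ _ => by simp only [τ]; omega)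
      (fun a _ _ _ => by simp only [τ]; omega)
  have huvne : u ≠ v := huv.ne
  have huW' : u ∉ W := by
    rintro (h | h)
    · have : 1 ≤ u.val ∧ u.val ≤ 3 * r + 3 := ⟨h.1, h.2.1⟩
      omega
    · exact hRu u h (Or.inl rfl)
  have hvW' : v ∉ W := by
    rintro (h | h)
    · have : 1 ≤ v.val ∧ v.val ≤ 3 * r + 3 := ⟨h.1, h.2.1⟩
      omega
    · exact hRv v h (Or.inl rfl)
  -- Removing the neighbours of `v` affects only the last third of the block, and removing those of
  -- `u` only the first third, so one of `a`, `2r + 3 + a` survives for each `a ≠ y`.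
  have hWv : ContractibleSpace (indSet G (W \ closedNbhd G v)) := by
    have : W \ closedNbhd G v = {w | (fun m => τ m ∧ m < 2 * r + 3 + y) w.val} ∪ R := by
      ext w
      simp only [W, Set.mem_sdiff, Set.mem_union, Set.mem_ofPred_eq]
      constructor
      · rintro ⟨h | h, h'⟩
        · refine Or.inl ⟨h, ?_⟩
          by_contra hlt
          exact h' (Or.inr ((hvW w h.1 h.2.1).2 (by omega)))
        · exact Or.inr h
      · rintro (⟨h, h'⟩ | h)
        · refine ⟨Or.inl h, ?_⟩
          rintro (hw | hw)
          · exact hvW' (hw ▸ Or.inl h)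
          · have := (hvW w h.1 h.2.1).1 hw
            omega
        · exact ⟨Or.inr h, hRv w h⟩
    rw [this]
    exact strip (fun m => τ m ∧ m < 2 * r + 3 + y) (fun m h => h.1)
      (fun m _ _ => by simp only [τ]; omega)
      (fun a _ _ _ => by simp only [τ]; omega)
  have hWu : ContractibleSpace (indSet G (W \ closedNbhd G u)) := by
    have : W \ closedNbhd G u = {w | (fun m => τ m ∧ r < m + x) w.val} ∪ R := by
      ext w
      simp only [W, Set.mem_sdiff, Set.mem_union, Set.mem_ofPred_eq]
      constructor
      · rintro ⟨h | h, h'⟩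
        · refine Or.inl ⟨h, ?_⟩
          by_contra hlt
          exact h' (Or.inr ((huW w h.1 h.2.1).2 (by omega)))
        · exact Or.inr h
      · rintro (⟨h, h'⟩ | h)
        · refine ⟨Or.inl h, ?_⟩
          rintro (hw | hw)
          · exact huW' (hw ▸ Or.inl h)
          · have := (huW w h.1 h.2.1).1 hw
            omega
        · exact ⟨Or.inr h, hRu w h⟩
    rw [this]
    exact strip (fun m => τ m ∧ r < m + x) (fun m h => h.1)
      (fun m _ _ => by simp only [τ]; omega)
      (fun a _ _ _ => by simp only [τ]; omega)
  -- The vertex `v` is added to `W`, then `u`; the link of `u` does not see `v` because `u` and `v`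
  -- are adjacent.
  have hvW1 : ContractibleSpace (indSet G (insert v W)) := by
    have h1 : (insert v W : Set (ZMod n)) \ {v} = W := Set.insert_sdiff_self_of_notMem hvW'
    have h2 : (insert v W : Set (ZMod n)) \ closedNbhd G v = W \ closedNbhd G v :=
      Set.insert_sdiff_of_mem _ (Or.inl rfl)
    refine contractibleSpace_indSet_of_vertex (v := v) (by simp) (hd := ?_) (hl := ?_)
    · rwa [h1]
    · rwa [h2]
  have hU : ContractibleSpace (indSet G (insert u (insert v W))) := by
    have h1 : (insert u (insert v W) : Set (ZMod n)) \ {u} = insert v W :=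
      Set.insert_sdiff_self_of_notMem (by simp [huvne, huW'])
    have h2 : (insert u (insert v W) : Set (ZMod n)) \ closedNbhd G u = W \ closedNbhd G u := by
      have hu : u ∈ closedNbhd G u := Or.inl rfl
      have hv : v ∈ closedNbhd G u := Or.inr huv
      rw [Set.insert_sdiff_of_mem _ hu, Set.insert_sdiff_of_mem _ hv]
    refine contractibleSpace_indSet_of_vertex (v := u) (by simp) (hd := ?_) (hl := ?_)
    · rwa [h1]
    · rwa [h2]
  refine ⟨_, ?_, hU⟩
  rintro w ((rfl | rfl) | hw)
  · simp
  · simp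
  · by_cases hwW : 1 ≤ w.val ∧ w.val ≤ 3 * r + 3
    · refine Or.inr (Or.inr (Or.inl ⟨hwW.1, hwW.2, fun h => hw ?_, fun h => hw ?_⟩))
      · exact Or.inl (Or.inr ((huW w hwW.1 hwW.2).2 (by omega)))
      · exact Or.inr (Or.inr ((hvW w hwW.1 hwW.2).2 (by omega)))
    · exact Or.inr (Or.inr (Or.inr ⟨hw, hwW⟩))

end SecondPhase
end IndCplx

namespace IndCplx

/-! ### The edge sequence -/

theorem PathCriterion.exists_contractible {V : Type*} [Fintype V] [DecidableEq V]
    {G : SimpleGraph V} {e : V × V} (h : PathCriterion G e) :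
    ∃ U, edgeAndFar G e ⊆ U ∧ ContractibleSpace (indSet G U) := by
  obtain ⟨x, y, hN, hxu, huv, hvy, hxv, hxy, huy, hxv', hxy', huy'⟩ := h
  refine ⟨{x, y, e.1, e.2} ∪ (edgeNbhd G e)ᶜ, ?_,
    contractibleSpace_of_path huv hvy hxv hxy huy hxv' huy' fun w hw => ⟨fun h => ?_, fun h => ?_,
      fun h => ?_⟩⟩
  · exact Set.union_subset_union_left _ (by simp [Set.insert_subset_iff])
  · exact hw (hN (Or.inl (Or.inr h)))
  · exact hw (hN (Or.inr (Or.inr h)))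
  · exact hw (Or.inr (Or.inl h))

theorem PathCriterion.exists_path {V : Type*} {G : SimpleGraph V} {e : V × V}
    (h : PathCriterion G e) :
    ∃ x ∈ edgeNbhd G e, ∃ y ∈ edgeNbhd G e, closedNbhd G x ∪ closedNbhd G y ⊆ edgeNbhd G e ∧
      Nonempty (G.induce {x, y, e.1, e.2} ≃g SimpleGraph.pathGraph 4) := by
  obtain ⟨x, y, hN, hxu, huv, hvy, hxv, hxy, huy, hxv', hxy', huy'⟩ := h
  exact ⟨x, hN (Or.inl (Or.inl rfl)), y, hN (Or.inr (Or.inl rfl)), hN,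
    nonempty_iso_pathGraph_four hxu huv hvy hxv hxy huy hxv' hxy' huy'⟩

variable {n r : ℕ}

theorem stageGraph_succ_adj {E : List (ZMod n × ZMod n)} (i : Fin E.length) (a b : ZMod n)
    (hne : (E.get i).1 ≠ (E.get i).2) :
    (stageGraph n r E (i + 1)).Adj a b ↔ (stageGraph n r E i).Adj a b ∨
      (a = (E.get i).1 ∧ b = (E.get i).2) ∨ (a = (E.get i).2 ∧ b = (E.get i).1) := by
  rw [stageGraph, stageGraph, ← List.take_concat_get' E i i.2, addEdges_adj, addEdges_adj]
  simp only [Set.mem_ofPred_eq, List.mem_append, List.mem_singleton, Prod.ext_iff,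
    List.get_eq_getElem] at *
  constructor
  · tauto
  · rintro (h | ⟨rfl, rfl⟩ | ⟨rfl, rfl⟩)
    · tauto
    · tauto
    · have := hne.symm
      tauto

theorem IsEdgeSequence.stageGraph_length {E : List (ZMod n × ZMod n)}
    (hE : IsEdgeSequence n r E) : stageGraph n r E E.length = cyclePowerBar n r := by
  obtain ⟨L, hL, hmem, rfl⟩ := hE
  rw [stageGraph, cyclePowerBar, List.take_length]
  congr 1
  ext f
  simp [hmem]

variable [NeZero n]

theorem not_mem_secondPhase_of_mem_firstPhase (hr : 1 ≤ r) (hn : 5 * r + 4 ≤ n)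
    {e : ZMod n × ZMod n} (h : e ∈ firstPhase n r) : e ∉ secondPhase n r := by
  rw [mem_firstPhase hr hn] at h
  rw [mem_secondPhase hn]
  simp only [FirstStages, Second] at *
  omega

theorem eq_iff_val {a b : ZMod n} {e : ZMod n × ZMod n} :
    (a, b) = e ↔ a.val = e.1.val ∧ b.val = e.2.val := by
  rw [Prod.ext_iff, (ZMod.val_injective n).eq_iff, (ZMod.val_injective n).eq_iff]

theorem firstPhase_step (hr : 1 ≤ r) (hn : 5 * r + 4 ≤ n) {A B : List (ZMod n × ZMod n)}
    {e : ZMod n × ZMod n} (h : firstPhase n r = A ++ e :: B) :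
    ¬ (addEdges (cyclePower n r) {f | f ∈ A}).Adj e.1 e.2 ∧
      PathCriterion (addEdges (cyclePower n r) {f | f ∈ A ++ [e]}) e := by
  obtain ⟨s, hs, hsr, ⟨h1, h2, h3, hA⟩ | ⟨h1, h2, h3, hA⟩⟩ := firstPhase_eq_append_cons hn h
  · constructor
    · rw [addEdges_cyclePower_adj]
      simp only [Set.mem_ofPred_eq, hA, FirstStages, Near]
      omega
    · refine pathCriterion_short hn hs hsr h1 h2 h3 fun a b => ?_
      rw [addEdges_cyclePower_adj]
      simp only [Set.mem_ofPred_eq, List.mem_append, List.mem_singleton, hA, eq_iff_val]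
      refine and_congr_right' (or_congr_right (or_congr ?_ ?_)) <;>
      · rw [or_assoc]
        refine or_congr_right ?_
        omega
  · constructor
    · rw [addEdges_cyclePower_adj]
      simp only [Set.mem_ofPred_eq, hA, FirstStages, Near]
      omega
    · refine pathCriterion_long hn hs hsr h1 h2 h3 fun a b => ?_
      rw [addEdges_cyclePower_adj]
      simp only [Set.mem_ofPred_eq, List.mem_append, List.mem_singleton, hA, eq_iff_val]
      refine and_congr_right' (or_congr_right (or_congr ?_ ?_)) <;>
      · rw [or_assoc, or_assoc]
        refine or_congr_right (or_congr_right ?_)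
        omega

/-- The contractibility argument needs the whole first phase, and of the second phase only some
subset of its edges containing `e`. Hence the order within the second phase is immaterial. -/
theorem secondPhase_step (hr : 1 ≤ r) (hn : 5 * r + 4 ≤ n) {A B : List (ZMod n × ZMod n)}
    {e : ZMod n × ZMod n} (hL : (A ++ e :: B).Nodup)
    (h : ∀ f, f ∈ A ++ e :: B ↔ f ∈ secondPhase n r) :
    ¬ (addEdges (cyclePower n r) {f | f ∈ firstPhase n r ++ A}).Adj e.1 e.2 ∧
      ∃ U, edgeAndFar (addEdges (cyclePower n r) {f | f ∈ firstPhase n r ++ A ++ [e]}) e ⊆ U ∧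
        ContractibleSpace
          (indSet (addEdges (cyclePower n r) {f | f ∈ firstPhase n r ++ A ++ [e]}) U) := by
  have he : Second n r e.1.val e.2.val := (mem_secondPhase hn).1 ((h e).1 (by simp))
  have heA : e ∉ A := fun hA => (List.nodup_append.1 hL).2.2 e hA e (by simp) rfl
  constructor
  · have hx := e.1.val_lt
    have hy := e.2.val_lt
    have hA' : (e.2, e.1) ∉ A := fun hA => by
      have := (mem_secondPhase hn).1 ((h _).1 (List.mem_append_left _ hA))
      simp only [Second] at *
      omega
    rw [addEdges_cyclePower_adj]
    simp only [Set.mem_ofPred_eq, List.mem_append, mem_firstPhase hr hn, Prod.mk.eta, heA, hA',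
      or_false, FirstStages, Near, Second] at *
    omega
  · refine exists_contractible_second hr hn (Q := fun a b => (a, b) ∈ A ++ [e])
      (fun a b hab => (mem_secondPhase hn).1 ((h (a, b)).1 ?_)) (by simp) fun a b => ?_
    · simp only [List.mem_append, List.mem_cons] at hab ⊢
      tauto
    · rw [addEdges_cyclePower_adj]
      simp only [Set.mem_ofPred_eq, List.append_assoc, List.mem_append (s := firstPhase n r),
        mem_firstPhase hr hn]

theorem IsEdgeSequence.step (hr : 1 ≤ r) (hn : 5 * r + 4 ≤ n) {A B : List (ZMod n × ZMod n)}
    {e : ZMod n × ZMod n} (h : IsEdgeSequence n r (A ++ e :: B)) :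
    e.1 ≠ e.2 ∧ ¬ (addEdges (cyclePower n r) {f | f ∈ A}).Adj e.1 e.2 ∧
      (e ∈ firstPhase n r → PathCriterion (addEdges (cyclePower n r) {f | f ∈ A ++ [e]}) e) ∧
      ∃ U, edgeAndFar (addEdges (cyclePower n r) {f | f ∈ A ++ [e]}) e ⊆ U ∧
        ContractibleSpace (indSet (addEdges (cyclePower n r) {f | f ∈ A ++ [e]}) U) := by
  obtain ⟨L, hL, hmem, hE⟩ := h
  have hne : e.1 ≠ e.2 := by
    have he : e ∈ firstPhase n r ++ L := hE ▸ (by simp)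
    rw [List.mem_append, hmem, mem_firstPhase hr hn, mem_secondPhase hn] at he
    intro h
    rw [h] at he
    have := e.2.val_lt
    simp only [FirstStages, Second] at he
    omega
  refine ⟨hne, ?_⟩
  have hcases : (∃ C, firstPhase n r = A ++ e :: C) ∨
      ∃ A', A = firstPhase n r ++ A' ∧ L = A' ++ e :: B := by
    rcases List.append_eq_append_iff.1 hE with ⟨C, hC, h'⟩ | ⟨A', hA', h'⟩
    · cases C with
      | nil => exact Or.inr ⟨[], by simpa using hC.symm, by simpa using h'.symm⟩
      | cons c C =>
        obtain ⟨rfl, -⟩ := List.cons.inj h'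
        exact Or.inl ⟨C, hC⟩
    · exact Or.inr ⟨A', hA', h'⟩
  rcases hcases with ⟨C, hC⟩ | ⟨A', rfl, rfl⟩
  · obtain ⟨h1, h2⟩ := firstPhase_step hr hn hC
    exact ⟨h1, fun _ => h2, h2.exists_contractible⟩
  · obtain ⟨h1, h2⟩ := secondPhase_step hr hn hL hmem
    exact ⟨h1, fun he => absurd ((hmem e).1 (by simp))
      (not_mem_secondPhase_of_mem_firstPhase hr hn he), h2⟩

theorem IsEdgeSequence.stageGraph_le {E : List (ZMod n × ZMod n)} (hE : IsEdgeSequence n r E)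
    (i : ℕ) : stageGraph n r E i ≤ cyclePowerBar n r := by
  obtain ⟨L, hL, hmem, rfl⟩ := hE
  intro a b
  rw [stageGraph, cyclePowerBar, addEdges_cyclePower_adj, addEdges_cyclePower_adj]
  have key : ∀ f, f ∈ (firstPhase n r ++ L).take i → f ∈ firstPhase n r ∨ f ∈ secondPhase n r :=
    fun f hf => by simpa [hmem] using List.mem_of_mem_take hf
  exact fun h => ⟨h.1, h.2.imp_right (Or.imp (key _) (key _))⟩

theorem stageGraph_zero (E : List (ZMod n × ZMod n)) : stageGraph n r E 0 = cyclePower n r := by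
  ext a b
  simp [stageGraph, addEdges_cyclePower_adj, cyclePower_adj]

/-- Makes every `Ind(G_i)` path-connected, since edges of the complement are segments of the
independence complex. The vertex `4r + 4` is non-adjacent to the whole block `1, …, 3r + 3`, where
`n ≥ 5r + 4` separates it from `1`; every other vertex is non-adjacent to one of `1`, `2r + 2`, `3r
+ 3`. -/
theorem preconnected_compl_cyclePowerBar (hr : 1 ≤ r) (hn : 5 * r + 4 ≤ n) :
    (cyclePowerBar n r)ᶜ.Preconnected := by
  have hadj : ∀ {a b : ZMod n}, a.val ≠ b.val → ¬ Near n r a.val b.val →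
      ¬ FirstStages r (r - 1) a.val b.val → ¬ FirstStages r (r - 1) b.val a.val →
      ¬ Second n r a.val b.val → ¬ Second n r b.val a.val → (cyclePowerBar n r)ᶜ.Adj a b := by
    intro a b h h1 h2 h3 h4 h5
    rw [SimpleGraph.compl_adj, cyclePowerBar, addEdges_cyclePower_adj]
    simp only [Set.mem_union, Set.mem_ofPred_eq, mem_firstPhase hr hn, mem_secondPhase hn]
    exact ⟨fun hab => h (hab ▸ rfl), by tauto⟩
  obtain ⟨c, hc⟩ := exists_zmod_val (n := n) (m := 4 * r + 4) (by omega)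
  obtain ⟨c₁, hc₁⟩ := exists_zmod_val (n := n) (m := 1) (by omega)
  obtain ⟨c₂, hc₂⟩ := exists_zmod_val (n := n) (m := 2 * r + 2) (by omega)
  obtain ⟨c₃, hc₃⟩ := exists_zmod_val (n := n) (m := 3 * r + 3) (by omega)
  have hmid : ∀ a : ZMod n, 1 ≤ a.val → a.val ≤ 3 * r + 3 → (cyclePowerBar n r)ᶜ.Adj a c := by
    intro a h1 h2
    apply hadj <;> simp only [Near, FirstStages, Second, hc] <;> omega
  have key : ∀ a, (cyclePowerBar n r)ᶜ.Reachable a c := by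
    intro a
    have ha := a.val_lt
    have hvia : ∀ b : ZMod n, 1 ≤ b.val → b.val ≤ 3 * r + 3 → (cyclePowerBar n r)ᶜ.Adj a b →
        (cyclePowerBar n r)ᶜ.Reachable a c := fun b h1 h2 h =>
      h.reachable.trans (hmid b h1 h2).reachable
    by_cases h0 : a.val = 0 ∨ n < a.val + r
    · refine hvia c₃ (by omega) (by omega) ?_
      apply hadj <;> simp only [Near, FirstStages, Second, hc₃] <;> omega
    by_cases h1 : a.val ≤ 3 * r + 3
    · exact (hmid a (by omega) h1).reachable
    by_cases h2 : a.val ≤ 4 * r + 3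
    · refine hvia c₁ (by omega) (by omega) ?_
      apply hadj <;> simp only [Near, FirstStages, Second, hc₁] <;> omega
    · refine hvia c₂ (by omega) (by omega) ?_
      apply hadj <;> simp only [Near, FirstStages, Second, hc₂] <;> omega
  exact fun a b => (key a).trans (key b).symm

theorem pathConnectedSpace_stageGraph (hr : 1 ≤ r) (hn : 5 * r + 4 ≤ n)
    {E : List (ZMod n × ZMod n)} (hE : IsEdgeSequence n r E) (i : ℕ) :
    PathConnectedSpace (indSet (stageGraph n r E i) Set.univ) :=
  pathConnectedSpace_indSet
    ((preconnected_compl_cyclePowerBar hr hn).mono (compl_le_compl (hE.stageGraph_le i)))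

/-! ### The splitting -/

theorem IsEdgeSequence.get_step (hr : 1 ≤ r) (hn : 5 * r + 4 ≤ n)
    {E : List (ZMod n × ZMod n)} (hE : IsEdgeSequence n r E) (i : Fin E.length) :
    (E.get i).1 ≠ (E.get i).2 ∧ ¬ (stageGraph n r E i).Adj (E.get i).1 (E.get i).2 ∧
      (E.get i ∈ firstPhase n r → PathCriterion (stageGraph n r E (i + 1)) (E.get i)) ∧
      ∃ U, edgeAndFar (stageGraph n r E (i + 1)) (E.get i) ⊆ U ∧
        ContractibleSpace (indSet (stageGraph n r E (i + 1)) U) := by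
  have h : E.take i ++ E.get i :: E.drop (i + 1) = E := by simp
  have h' : E.take i ++ [E.get i] = E.take (i + 1) := by simp
  have := IsEdgeSequence.step hr hn (h.symm ▸ hE)
  rwa [h'] at this

theorem PtdEquiv.of_eq {V : Type*} {s t : Set V} [TopologicalSpace V] (h : s = t) (x : s) (y : t)
    (hxy : x.1 = y.1) : PtdEquiv x y := by
  have := PtdEquiv.of_homeomorph (Homeomorph.setCongr h) x
  rwa [show Homeomorph.setCongr h x = y from Subtype.ext hxy] at this

theorem IsEdgeSequence.splitting (hr : 1 ≤ r) (hn : 5 * r + 4 ≤ n)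
    {E : List (ZMod n × ZMod n)} (hE : IsEdgeSequence n r E)
    (p : Realization (Ind (cyclePowerBar n r))) :
    Nonempty (ContinuousMap.HomotopyEquiv (Realization (Ind (cyclePower n r)))
      (Wedge p (fun i : Fin E.length => Susp.pole (Susp (Realization (Ind
        ((stageGraph n r E (i + 1)).induce
          (edgeNbhd (stageGraph n r E (i + 1)) (E.get i))ᶜ))))))) := by
  -- Adding edges shrinks the independence complex, so a point of the last one lies in all of them
  -- and serves as base point throughout.
  have hp : ∀ i, p.1 ∈ indSet (stageGraph n r E i) Set.univ := fun i =>
    indSet_anti (hE.stageGraph_le i) (by rw [indSet_univ]; exact p.2)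
  have hmain := PtdEquiv.wedge_of_forall
    (fun i => indSet (stageGraph n r E i) Set.univ) (fun i => ⟨p.1, hp i⟩)
    (fun i : Fin E.length => Susp (Susp (Realization (Ind ((stageGraph n r E (i + 1)).induce
          (edgeNbhd (stageGraph n r E (i + 1)) (E.get i))ᶜ)))))
    (fun i => Susp.pole _) (fun i => by
      obtain ⟨hne, hnadj, -, U, hU, hc⟩ := hE.get_step hr hn i
      have := pathConnectedSpace_stageGraph hr hn hE (i + 1)
      exact ptdEquiv_of_edge hne hnadj (fun a b => stageGraph_succ_adj i a b hne) hU _ _ rfl)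
  have h0 : p.1 ∈ realizationSet (Ind (cyclePower n r)) := by
    rw [← stageGraph_zero E, ← indSet_univ]
    exact hp 0
  have hstart := PtdEquiv.of_eq
    (by rw [← stageGraph_zero E, indSet_univ] :
      realizationSet (Ind (cyclePower n r)) = indSet (stageGraph n r E 0) Set.univ)
    ⟨p.1, h0⟩ ⟨p.1, hp 0⟩ rfl
  have hend := PtdEquiv.of_eq
    (by rw [hE.stageGraph_length, indSet_univ] :
      indSet (stageGraph n r E E.length) Set.univ = realizationSet (Ind (cyclePowerBar n r)))
    ⟨p.1, hp _⟩ p rfl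
  exact ((hstart.trans hmain).trans (PtdEquiv.wedge _ hend)).nonempty_homotopyEquiv

end IndCplx

theorem mainTheorem4 (r n : ℕ) [NeZero n] (hr : 1 ≤ r) (hn : 5 * r + 4 ≤ n)
    (E : List (ZMod n × ZMod n)) (hE : IndCplx.IsEdgeSequence n r E) :
    -- `E.get i` is `e_{i+1}`; it is added to `G_i` and gives `G_{i+1}`
    (∀ i : Fin E.length,
      -- it is a new edge
      (E.get i).1 ≠ (E.get i).2 ∧
      ¬ (IndCplx.stageGraph n r E i).Adj (E.get i).1 (E.get i).2 ∧
      -- the inclusion is null-homotopic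
      (IndCplx.indInclusion (IndCplx.stageGraph n r E (i + 1))
        (IndCplx.edgeAndFar (IndCplx.stageGraph n r E (i + 1)) (E.get i))).Nullhomotopic ∧
      -- first phase: the criterion with an induced four-vertex path
      (E.get i ∈ IndCplx.firstPhase n r →
        ∃ x ∈ IndCplx.edgeNbhd (IndCplx.stageGraph n r E (i + 1)) (E.get i),
        ∃ y ∈ IndCplx.edgeNbhd (IndCplx.stageGraph n r E (i + 1)) (E.get i),
          IndCplx.closedNbhd (IndCplx.stageGraph n r E (i + 1)) x ∪
              IndCplx.closedNbhd (IndCplx.stageGraph n r E (i + 1)) y ⊆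
            IndCplx.edgeNbhd (IndCplx.stageGraph n r E (i + 1)) (E.get i) ∧
          Nonempty ((IndCplx.stageGraph n r E (i + 1)).induce
            {x, y, (E.get i).1, (E.get i).2} ≃g SimpleGraph.pathGraph 4)) ∧
      -- second phase: the inclusion factors through a contractible induced subcomplex
      (E.get i ∈ IndCplx.secondPhase n r →
        ∃ U : Set (ZMod n),
          IndCplx.edgeAndFar (IndCplx.stageGraph n r E (i + 1)) (E.get i) ⊆ U ∧
          ContractibleSpace (IndCplx.Realization
            (IndCplx.Ind ((IndCplx.stageGraph n r E (i + 1)).induce U))))) ∧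
    -- the last graph is the full one
    IndCplx.stageGraph n r E E.length = IndCplx.cyclePowerBar n r ∧
    -- the splitting, for every choice of base point
    (∀ p : IndCplx.Realization (IndCplx.Ind (IndCplx.cyclePowerBar n r)),
      Nonempty (ContinuousMap.HomotopyEquiv
        (IndCplx.Realization (IndCplx.Ind (IndCplx.cyclePower n r)))
        (IndCplx.Wedge p (fun i : Fin E.length =>
          IndCplx.Susp.pole (IndCplx.Susp (IndCplx.Realization (IndCplx.Ind
            ((IndCplx.stageGraph n r E (i + 1)).induce
              (IndCplx.edgeNbhd (IndCplx.stageGraph n r E (i + 1)) (E.get i))ᶜ)))))))) := by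
  refine ⟨fun i => ?_, hE.stageGraph_length, hE.splitting hr hn⟩
  obtain ⟨hne, hnadj, hpath, U, hU, hc⟩ := hE.get_step hr hn i
  exact ⟨hne, hnadj, IndCplx.nullhomotopic_indInclusion hU, fun h => (hpath h).exists_path,
    fun _ => ⟨U, hU, (IndCplx.realizationHomeomorph _ U).contractibleSpace⟩⟩
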